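/- Let $\mathcal G$ be a finite connected graph, in which self-loops and multiple edges are allowed, without leaves (no vertex of degree $1$; a self-loop counts twice in the degree). Let $p=\#V(\mathcal G)$, let $b(v)\in\mathbb R$ be a potential on the vertices, and let $a(e)>0$ be a coupling on the edges. Let $\pi:\mathcal T\to\mathcal G$ be the universal cover (a tree), lift the parameters by $b(\tilde v)=b(\pi(\tilde v))$, $a(\tilde e)=a(\pi(\tilde e))$, and let $H$ be the bounded self-adjoint operator on $\ell^2(V(\mathcal T))$ with matrix entries $H_{\tilde v\tilde v}=b(\tilde v)$, $H_{\tilde v\tilde w}=a(\tilde e)$ if $\tilde v$ and $\tilde w$ are joined by an edge $\tilde e$ of $\mathcal T$, and $H_{\tilde v\tilde w}=0$ otherwise. For $v\in V(\mathcal G)$ let $d\mu_v$ be the spectral measure of $H$ and $\delta_{\tilde v}$, where $\tilde v$ is any vertex with $\pi(\tilde v)=v$ (the measure does not depend on this choice). Let $dk=\frac1p\sum_{v\in V(\mathcal G)}d\mu_v$ be the density of states measure and $k(E)=dk((-\infty,E))$ the integrated density of states. Then on every gap of the spectrum of $H$, that is, on every connected component of $\mathbb R\setminus\mathrm{spec}(H)$,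 the function $k$ is constant and its value is an integer multiple of $1/p$. Moreover, the spectrum of $H$ has at most $p$ connected components. -/

import Mathlib

open scoped ENNReal CompactlySupported

/-! ### Finite graphs with loops and multiple edges -/

/-- A graph, possibly with self-loops and multiple edges. `V` is the set of vertices and `E` the
set of *oriented* edges: every geometric edge (a loop too) gives two distinct elements `e` and
`rev e` of `E`, with opposite directions. -/
structure MultiGraph (V E : Type*) where
  src : E → V
  tgt : E → V
  rev : E → E
  rev_rev : ∀ e, rev (rev e) = e
  rev_ne : ∀ e, rev e ≠ e
  src_rev : ∀ e, src (rev e) = tgt e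

namespace MultiGraph

theorem tgt_rev {V E : Type*} (G : MultiGraph V E) (e : E) : G.tgt (G.rev e) = G.src e := by
  rw [← G.src_rev, G.rev_rev]

/-- Any two vertices are joined by a finite sequence of oriented edges, and there is a vertex. -/
def Connected {V E : Type*} (G : MultiGraph V E) : Prop :=
  Nonempty V ∧ ∀ u v : V,
    Relation.ReflTransGen (fun x y => ∃ e, G.src e = x ∧ G.tgt e = y) u v

/-- The degree of a vertex: the number of oriented edges that leave it (a loop counts twice). -/
noncomputable def degree {V E : Type*} (G : MultiGraph V E) (v : V) : ℕ :=
  Nat.card {e : E // G.src e = v}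

/-- There are no leaves, that is, no vertices of degree one. -/
def Leafless {V E : Type*} (G : MultiGraph V E) : Prop :=
  ∀ v, G.degree v ≠ 1

/-! ### The universal cover

The universal cover of a connected graph is realized, as usual, as the tree of reduced
(non-backtracking) edge paths that start at a base vertex `v₀`. A path is stored as the list of
its oriented edges, *last edge first*. The covering map sends a path to its final vertex. Two
paths are neighbours in the tree if one of them extends the other one by one edge. -/

/-- The final vertex of a path that starts at `v₀`. -/
def endpoint {V E : Type*} (G : MultiGraph V E) (v₀ : V) : List E → V
  | [] => v₀
  | e :: _ => G.tgt e

/-- The list is a path that starts at `v₀`, and no edge is directly followed by its reverse. -/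
def IsReduced {V E : Type*} (G : MultiGraph V E) (v₀ : V) : List E → Prop
  | [] => True
  | e :: l => G.IsReduced v₀ l ∧ G.src e = G.endpoint v₀ l ∧ l.head? ≠ some (G.rev e)

/-- The vertex set of the universal cover. -/
@[ext] structure Cover {V E : Type*} (G : MultiGraph V E) (v₀ : V) where
  path : List E
  reduced : G.IsReduced v₀ path

namespace Cover

/-- The covering map on vertices. -/
def proj {V E : Type*} {G : MultiGraph V E} {v₀ : V} (x : G.Cover v₀) : V :=
  G.endpoint v₀ x.path

open Classical in
/-- The oriented edges of the universal cover that leave the vertex `x` are the lifts of the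
oriented edges `e` of `G` that leave `x.proj`, one for each `e`. The lift of `e` ends at `x.next e`:
if the last edge of the path `x` is `rev e` then that edge is removed, else `e` is appended. -/
noncomputable def next {V E : Type*} {G : MultiGraph V E} {v₀ : V} (x : G.Cover v₀) (e : E)
    (h : G.src e = x.proj) : G.Cover v₀ :=
  if hb : x.path.head? = some (G.rev e) then
    ⟨x.path.tail, by
      obtain ⟨l, hl⟩ := x
      cases l with
      | nil => trivial
      | cons f l => exact hl.1⟩
  else ⟨e :: x.path, x.reduced, h, hb⟩

theorem next_val_of_back {V E : Type*} {G : MultiGraph V E} {v₀ : V} (x : G.Cover v₀) (e : E)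
    (h : G.src e = x.proj) (hb : x.path.head? = some (G.rev e)) : (x.next e h).path = x.path.tail := by
  unfold next
  rw [dif_pos hb]

theorem next_val_of_forth {V E : Type*} {G : MultiGraph V E} {v₀ : V} (x : G.Cover v₀) (e : E)
    (h : G.src e = x.proj) (hb : x.path.head? ≠ some (G.rev e)) : (x.next e h).path = e :: x.path := by
  unfold next
  rw [dif_neg hb]

theorem proj_next {V E : Type*} {G : MultiGraph V E} {v₀ : V} (x : G.Cover v₀) (e : E)
    (h : G.src e = x.proj) : (x.next e h).proj = G.tgt e := by
  by_cases hb : x.path.head? = some (G.rev e)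
  · unfold proj
    rw [next_val_of_back x e h hb]
    obtain ⟨l, hl⟩ := x
    cases l with
    | nil => simp at hb
    | cons f l =>
      simp only [List.head?_cons, Option.some.injEq] at hb
      subst hb
      have := hl.2.1
      rw [G.src_rev] at this
      exact this.symm
  · unfold proj
    rw [next_val_of_forth x e h hb]
    rfl

/-- Lifting `e` and then `rev e` leads back to the starting vertex. -/
theorem next_next {V E : Type*} {G : MultiGraph V E} {v₀ : V} (x : G.Cover v₀) (e : E)
    (h : G.src e = x.proj) (h' : G.src (G.rev e) = (x.next e h).proj) :
    (x.next e h).next (G.rev e) h' = x := by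
  apply Cover.ext
  by_cases hb : x.path.head? = some (G.rev e)
  · have h1 := next_val_of_back x e h hb
    have hx : x.path = G.rev e :: x.path.tail := by
      obtain ⟨l, hl⟩ := x
      cases l with
      | nil => simp at hb
      | cons f l => simpa using hb
    have hr := x.reduced
    rw [hx] at hr
    rw [next_val_of_forth _ _ _ (by rw [h1]; exact hr.2.2), h1, ← hx]
  · have h1 := next_val_of_forth x e h hb
    rw [next_val_of_back _ _ _ (by rw [h1, G.rev_rev]; rfl), h1, List.tail_cons]

/-- The universal cover has no loops. -/
theorem next_ne {V E : Type*} {G : MultiGraph V E} {v₀ : V} (x : G.Cover v₀) (e : E)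
    (h : G.src e = x.proj) : x.next e h ≠ x := by
  intro hx
  have hx := congrArg (fun y => y.path.length) hx
  by_cases hb : x.path.head? = some (G.rev e)
  · rw [next_val_of_back x e h hb] at hx
    have : x.path ≠ [] := by
      intro h0
      simp [h0] at hb
    have := List.length_pos_of_ne_nil this
    rw [List.length_tail] at hx
    omega
  · rw [next_val_of_forth x e h hb] at hx
    simp at hx

/-- The universal cover has no multiple edges. -/
theorem next_injective {V E : Type*} {G : MultiGraph V E} {v₀ : V} (x : G.Cover v₀) (e f : E)
    (he : G.src e = x.proj) (hf : G.src f = x.proj) (hef : x.next e he = x.next f hf) :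
    e = f := by
  have hx := congrArg path hef
  by_cases h1 : x.path.head? = some (G.rev e) <;> by_cases h2 : x.path.head? = some (G.rev f)
  · rw [h1] at h2
    simpa [G.rev_rev] using congrArg G.rev (Option.some.inj h2)
  · rw [next_val_of_back x e he h1, next_val_of_forth x f hf h2] at hx
    exact absurd (congrArg List.length hx) (by simp [List.length_tail]; try omega)
  · rw [next_val_of_forth x e he h1, next_val_of_back x f hf h2] at hx
    exact absurd (congrArg List.length hx) (by simp; omega)
  · rw [next_val_of_forth x e he h1, next_val_of_forth x f hf h2] at hx
    exact (List.cons.inj hx).1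

open Classical in
/-- The partial bijection `x ↦ x.next e` of the vertices of the universal cover, defined for the
vertices over the initial vertex of `e`. -/
noncomputable def move {V E : Type*} (G : MultiGraph V E) (v₀ : V) (e : E) :
    PEquiv (G.Cover v₀) (G.Cover v₀) where
  toFun x := if h : G.src e = x.proj then some (x.next e h) else none
  invFun x := if h : G.src (G.rev e) = x.proj then some (x.next (G.rev e) h) else none
  inv x y := by
    constructor
    · intro hx
      simp only [Option.dite_none_right_eq_some, Option.some.injEq] at hx ⊢
      obtain ⟨h, rfl⟩ := hx
      refine ⟨by rw [proj_next, G.tgt_rev], ?_⟩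
      have key : ∀ e' (h1 : G.src e' = (y.next (G.rev e) h).proj), e' = G.rev (G.rev e) →
          (y.next (G.rev e) h).next e' h1 = y := by
        rintro _ h1 rfl
        exact next_next y _ h h1
      exact key e _ (G.rev_rev e).symm
    · intro hx
      simp only [Option.dite_none_right_eq_some, Option.some.injEq] at hx ⊢
      obtain ⟨h, rfl⟩ := hx
      exact ⟨by rw [proj_next, G.src_rev], next_next x e h _⟩

/-- Every vertex of a connected graph has a lift to the universal cover. -/
theorem proj_surjective {V E : Type*} {G : MultiGraph V E} (hG : G.Connected) (v₀ : V) :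
    Function.Surjective (proj : G.Cover v₀ → V) := by
  intro v
  induction hG.2 v₀ v with
  | refl => exact ⟨⟨[], trivial⟩, rfl⟩
  | tail _ h ih =>
    obtain ⟨e, he, rfl⟩ := h
    obtain ⟨x, hx⟩ := ih
    exact ⟨x.next e (he.trans hx.symm), proj_next _ _ _⟩

end Cover

end MultiGraph

/-! ### The periodic Jacobi matrix -/

/-- The space `ℓ²(X)`. -/
abbrev EllTwo (X : Type*) : Type _ := lp (fun _ : X => ℂ) 2

open Classical in
/-- The vector `δ_x` of the standard orthonormal basis of `ℓ²(X)`. -/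
noncomputable def EllTwo.delta {X : Type*} (x : X) : EllTwo X := lp.single 2 x (1 : ℂ)

namespace EllTwo

theorem sum_shift_le {X : Type*} (f : PEquiv X X) (ψ : EllTwo X) (s : Finset X) :
    ∑ x ∈ s, ‖(f x).elim 0 ψ‖ ^ (2 : ℝ≥0∞).toReal ≤ ‖ψ‖ ^ (2 : ℝ≥0∞).toReal := by
  classical
  have h2 : 0 < (2 : ℝ≥0∞).toReal := by norm_num
  have h1 : ∑ x ∈ s, ‖(f x).elim 0 ψ‖ ^ (2 : ℝ≥0∞).toReal
      = ∑ y ∈ s.biUnion (fun x => (f x).toFinset), ‖ψ y‖ ^ (2 : ℝ≥0∞).toReal := by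
    rw [Finset.sum_biUnion]
    · refine Finset.sum_congr rfl fun x _ => ?_
      cases f x <;> simp
    · intro x _ y _ hxy
      rw [Function.onFun, Finset.disjoint_left]
      intro z hx hy
      rw [Option.mem_toFinset] at hx hy
      exact hxy (f.inj hx hy)
  rw [h1]
  exact lp.sum_rpow_le_norm_rpow h2 ψ _

/-- The partial isometry `(S ψ)(x) = ψ(f x)` of `ℓ²(X)` given by a partial bijection `f` of `X`,
where `ψ(f x)` is read as `0` if `f x` is undefined. -/
noncomputable def shift {X : Type*} (f : PEquiv X X) : EllTwo X →L[ℂ] EllTwo X :=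
  LinearMap.mkContinuous
    { toFun := fun ψ => ⟨fun x => (f x).elim 0 ψ, memℓp_gen' (sum_shift_le f ψ)⟩
      map_add' := fun ψ φ => by
        apply lp.ext
        funext x
        simp only [lp.coeFn_add, Pi.add_apply]
        cases f x <;> simp
      map_smul' := fun c ψ => by
        apply lp.ext
        funext x
        simp only [lp.coeFn_smul, Pi.smul_apply, RingHom.id_apply]
        cases f x <;> simp }
    1 (fun ψ => by
      rw [one_mul]
      exact lp.norm_le_of_forall_sum_le (by norm_num) (norm_nonneg _) (sum_shift_le f ψ))

theorem shift_apply {X : Type*} (f : PEquiv X X) (ψ : EllTwo X) (x : X) :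
    shift f ψ x = (f x).elim 0 ψ := rfl

theorem inner_delta_left {X : Type*} (x : X) (ψ : EllTwo X) : inner ℂ (delta x) ψ = ψ x := by
  simp [delta, lp.inner_single_left]

theorem delta_apply {X : Type*} (x y : X) [Decidable (x = y)] :
    (delta x : X → ℂ) y = if x = y then 1 else 0 := by
  classical
  by_cases h : x = y
  · subst h; simp [delta]
  · rw [if_neg h, delta, lp.single_apply_ne _ _ _ (Ne.symm h)]

theorem adjoint_shift {X : Type*} (f : PEquiv X X) :
    ContinuousLinearMap.adjoint (shift f) = shift f.symm := by
  classical
  symm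
  rw [ContinuousLinearMap.eq_adjoint_iff]
  intro ψ φ
  rw [lp.inner_eq_tsum, lp.inner_eq_tsum]
  simp only [shift_apply]
  have hsupp : ∀ y : Function.support (fun y => inner ℂ ((f.symm y).elim 0 ψ) (φ y)),
      ∃ x, f.symm y = some x := by
    intro y
    by_contra! hx
    have : f.symm y = none := Option.eq_none_iff_forall_ne_some.2 hx
    exact y.2 (by simp [this])
  choose g hg using hsupp
  symm
  refine tsum_eq_tsum_of_ne_zero_bij g ?_ ?_ ?_
  · intro y z hyz
    apply Subtype.ext
    exact f.symm.inj (hg y) (by rw [hyz]; exact hg z)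
  · intro x hx
    have : ∃ y, f x = some y := by
      by_contra! hy
      have : f x = none := Option.eq_none_iff_forall_ne_some.2 hy
      exact hx (by simp [this])
    obtain ⟨y, hy⟩ := this
    have hy' : f.symm y = some x := f.eq_some_iff.2 hy
    refine ⟨⟨y, ?_⟩, ?_⟩
    · simpa [hy, hy'] using hx
    · exact Option.some.inj ((hg _).symm.trans hy')
  · intro y
    have h1 := hg y
    have h2 : f (g y) = some y.1 := f.eq_some_iff.1 h1
    simp [h1, h2]

end EllTwo

/-- Jacobi parameters of a graph: a real potential `b` on the vertices and a positive coupling `a`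
on the edges, which does not depend on the orientation. -/
structure JacobiParameters {V E : Type*} (G : MultiGraph V E) where
  b : V → ℝ
  a : E → ℝ
  a_pos : ∀ e, 0 < a e
  a_rev : ∀ e, a (G.rev e) = a e

namespace JacobiParameters

open Classical in
/-- The infinite matrix indexed by the vertices of the universal cover whose entries are the lifted
Jacobi parameters: `b` on the diagonal, the coupling of the edge for neighbours, and zero for all
other pairs (for given `x` and `y` at most one `e` satisfies the condition). -/
noncomputable def matrix {V E : Type*} [Fintype E] {G : MultiGraph V E} (J : JacobiParameters G)
    (v₀ : V) : Matrix (G.Cover v₀) (G.Cover v₀) ℝ :=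
  fun x y => if x = y then J.b x.proj
    else ∑ e : E, if ∃ h : G.src e = x.proj, x.next e h = y then J.a e else 0

open Classical in
/-- The periodic Jacobi matrix as a bounded operator `H` on `ℓ²` of the vertices of the universal
cover:
`(H ψ)(x) = b(x) ψ(x) + ∑ a(e) ψ(y)`, the sum being over the edges `e` from `x` to `y`. -/
noncomputable def H {V E : Type*} [Fintype V] [Fintype E] {G : MultiGraph V E}
    (J : JacobiParameters G) (v₀ : V) : EllTwo (G.Cover v₀) →L[ℂ] EllTwo (G.Cover v₀) :=
  ∑ v : V, (J.b v : ℂ) • EllTwo.shift (PEquiv.ofSet {x : G.Cover v₀ | x.proj = v})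
    + ∑ e : E, (J.a e : ℂ) • EllTwo.shift (MultiGraph.Cover.move G v₀ e)

open Classical in
theorem H_apply {V E : Type*} [Fintype V] [Fintype E] {G : MultiGraph V E}
    (J : JacobiParameters G) (v₀ : V) (ψ : EllTwo (G.Cover v₀)) (x : G.Cover v₀) :
    J.H v₀ ψ x = J.b x.proj * ψ x
      + ∑ e : E, if h : G.src e = x.proj then J.a e * ψ (x.next e h) else 0 := by
  have h0 : J.H v₀ ψ x
      = ∑ v : V, J.b v *
          ((PEquiv.ofSet {x : G.Cover v₀ | x.proj = v} x).elim 0 ψ : ℂ)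
        + ∑ e : E, J.a e * ((MultiGraph.Cover.move G v₀ e x).elim 0 ψ : ℂ) := by
    rw [← EllTwo.inner_delta_left]
    simp only [H, add_apply, sum_apply, smul_apply,
      inner_add_right, inner_sum, inner_smul_right, EllTwo.inner_delta_left, EllTwo.shift_apply]
  rw [h0]
  congr 1
  · rw [Finset.sum_eq_single x.proj]
    · simp [PEquiv.ofSet]
    · intro v _ hv
      simp [PEquiv.ofSet, hv.symm]
    · simp
  · refine Finset.sum_congr rfl fun e _ => ?_
    by_cases h : G.src e = x.proj
    · simp [MultiGraph.Cover.move, h]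
    · simp [MultiGraph.Cover.move, h]

/-- The matrix entries of the operator `H` in the standard basis are the prescribed ones. -/
theorem inner_H_delta {V E : Type*} [Fintype V] [Fintype E] {G : MultiGraph V E}
    (J : JacobiParameters G) (v₀ : V) (x y : G.Cover v₀) :
    inner ℂ (EllTwo.delta x) (J.H v₀ (EllTwo.delta y)) = J.matrix v₀ x y := by
  classical
  rw [EllTwo.inner_delta_left, H_apply]
  simp only [EllTwo.delta_apply]
  unfold matrix
  by_cases hxy : x = y
  · subst hxy
    rw [if_pos rfl, if_pos rfl, mul_one, add_eq_left]
    refine Finset.sum_eq_zero fun e _ => ?_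
    split_ifs with h1 h2
    · exact absurd h2.symm (x.next_ne e h1)
    · simp
    · rfl
  · rw [if_neg (Ne.symm hxy), if_neg hxy, mul_zero, zero_add]
    push_cast
    refine Finset.sum_congr rfl fun e _ => ?_
    by_cases h : G.src e = x.proj
    · by_cases h' : x.next e h = y
      · simp [h, h']
      · simp [h, h', Ne.symm h']
    · simp [h]

theorem isSelfAdjoint_H {V E : Type*} [Fintype V] [Fintype E] {G : MultiGraph V E}
    (J : JacobiParameters G) (v₀ : V) : IsSelfAdjoint (J.H v₀) := by
  classical
  have hmove : ∀ e, (MultiGraph.Cover.move G v₀ e).symm = MultiGraph.Cover.move G v₀ (G.rev e) :=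
    fun e => PEquiv.ext fun x => rfl
  rw [ContinuousLinearMap.isSelfAdjoint_iff']
  unfold H
  simp only [map_add, map_sum, map_smulₛₗ, Complex.conj_ofReal, EllTwo.adjoint_shift,
    PEquiv.ofSet_symm, hmove]
  congr 1
  refine Finset.sum_nbij' G.rev G.rev (by simp) (by simp) (by simp [G.rev_rev])
    (by simp [G.rev_rev]) ?_
  intro e _
  rw [J.a_rev]

end JacobiParameters

/-! ### Spectral measures, density of states, gaps -/

/-- The positive functional `f ↦ ⟪φ, f(A) φ⟫` on the continuous functions with compact support. -/
noncomputable def spectralFunctional {K : Type*} [NormedAddCommGroup K] [InnerProductSpace ℂ K]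
    [CompleteSpace K] (A : K →L[ℂ] K) (φ : K) : C_c(ℝ, ℝ) →ₚ[ℝ] ℝ where
  toFun f := (inner ℂ φ (cfc (f : ℝ → ℝ) A φ)).re
  map_add' f g := by
    have h := cfc_add (a := A) (fun x => f x) (fun x => g x) (map_continuous f).continuousOn
      (map_continuous g).continuousOn
    have h' : cfc (⇑(f + g)) A = cfc (⇑f) A + cfc (⇑g) A := h
    rw [h', add_apply, inner_add_right, Complex.add_re]
  map_smul' c f := by
    have h := cfc_const_mul (a := A) c (fun x => f x) (map_continuous f).continuousOn
    have h' : cfc (⇑(c • f)) A = c • cfc (⇑f) A := h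
    rw [h', smul_apply, ← Complex.coe_smul, inner_smul_right,
      Complex.re_ofReal_mul, RingHom.id_apply, smul_eq_mul]
  monotone' f g hfg := by
    have h := cfc_mono (a := A) (f := fun x => f x) (g := fun x => g x) (fun x _ => hfg x)
      (map_continuous f).continuousOn (map_continuous g).continuousOn
    have h' := ((ContinuousLinearMap.le_def _ _).1 h).re_inner_nonneg_right φ
    rw [sub_apply, inner_sub_right, map_sub] at h'
    exact sub_nonneg.1 h'

/-- The spectral measure of a bounded self-adjoint operator `A` and a vector `φ`: the measure `μ`
on `ℝ` with `∫ f dμ = ⟪φ, f(A) φ⟫` for continuous `f` with compact support. -/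
noncomputable def spectralMeasure {K : Type*} [NormedAddCommGroup K] [InnerProductSpace ℂ K]
    [CompleteSpace K] (A : K →L[ℂ] K) (φ : K) : MeasureTheory.Measure ℝ :=
  RealRMK.rieszMeasure (spectralFunctional A φ)

theorem integral_spectralMeasure {K : Type*} [NormedAddCommGroup K] [InnerProductSpace ℂ K]
    [CompleteSpace K] (A : K →L[ℂ] K) (φ : K) (f : C_c(ℝ, ℝ)) :
    ∫ t, f t ∂(spectralMeasure A φ) = (inner ℂ φ (cfc (f : ℝ → ℝ) A φ)).re :=
  RealRMK.integral_rieszMeasure (spectralFunctional A φ) f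

/-- A gap of the spectrum of a (self-adjoint) operator `A`: a connected component, bounded or not,
of the set of real numbers that do not belong to the spectrum. -/
def IsSpectralGap {K : Type*} [NormedAddCommGroup K] [InnerProductSpace ℂ K]
    (A : K →L[ℂ] K) (I : Set ℝ) : Prop :=
  ∃ t₀ : ℝ, (t₀ : ℂ) ∉ spectrum ℂ A ∧
    I = connectedComponentIn {t : ℝ | (t : ℂ) ∉ spectrum ℂ A} t₀

namespace JacobiParameters

/-- The density of states measure: the average, over the vertices `v` of the finite graph, of the
spectral measure of `H` and `δ_x`, where `x = lift v` is a vertex of the universal cover over `v`. -/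
noncomputable def densityOfStates {V E : Type*} [Fintype V] [Fintype E] {G : MultiGraph V E}
    (J : JacobiParameters G) (v₀ : V) (lift : V → G.Cover v₀) : MeasureTheory.Measure ℝ :=
  (Fintype.card V : ℝ≥0∞)⁻¹ • ∑ v : V, spectralMeasure (J.H v₀) (EllTwo.delta (lift v))

/-- The integrated density of states. -/
noncomputable def ids {V E : Type*} [Fintype V] [Fintype E] {G : MultiGraph V E}
    (J : JacobiParameters G) (v₀ : V) (lift : V → G.Cover v₀) (t : ℝ) : ℝ≥0∞ :=
  J.densityOfStates v₀ lift (Set.Iio t)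

end JacobiParameters

/-! For z in the resolvent set, let s_v and t_e be the entries of (z - H)⁻¹ on the diagonal over v
and across a lift of e; deck transformations make them independent of the lifts. The resolvent
equation gives (z - b_v) s_v - Σ a_e t_e = 1 at each vertex. Cutting an edge disconnects the tree,
which gives a_e s_v s_w = t_e (1 + a_e t_e) for an edge e from v to w (`green_edge`).
Differentiating both families and eliminating b_v shows that Q = ∏ (1 + a_e t_e) / ∏ s_v, with one
factor per geometric edge in the numerator, has logarithmic derivative Σ_v s_v (`sum_logDeriv_eq`).

The same sum is the derivative of L(z) = Σ_v ∫ log(z - t) dμ_v(t), so exp L = c Q on the upper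
half-plane (`exists_exp_logPotential_eq`). Let z tend to a real x in a gap at which no s_v vanishes.
Then Im L tends to π N(x) with N(x) = Σ_v μ_v((x, ∞)), while Q has a real nonzero limit. Hence
exp(2πi N(x)) = (c/|c|)², the same number for all such x. Above the spectrum N = 0, so the number is
1 and N is always an integer; p k = p - N is then an integer too. The excluded x are isolated, and k
does not change inside a gap.

For the number of components, Σ_v μ_v charges every neighbourhood of every point of the spectrum.
Its distribution function, an integer between 0 and p in the gaps, therefore grows by at least 1
whenever a piece of spectrum is crossed. -/

namespace MultiGraph.Cover

/-! ### Deck transformations of the universal cover -/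

variable {V E : Type*} {G : MultiGraph V E} {v₀ : V}

/-- The trivial path. -/
def root (G : MultiGraph V E) (v₀ : V) : G.Cover v₀ := ⟨[], trivial⟩

/-- The path without its last edge. -/
def init {e : E} {l : List E} (h : G.IsReduced v₀ (e :: l)) : G.Cover v₀ := ⟨l, h.1⟩

theorem src_eq_proj_init {e : E} {l : List E} (h : G.IsReduced v₀ (e :: l)) :
    G.src e = (init h).proj := h.2.1

theorem next_init {e : E} {l : List E} (h : G.IsReduced v₀ (e :: l)) :
    (init h).next e (src_eq_proj_init h) = ⟨e :: l, h⟩ :=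
  Cover.ext (next_val_of_forth _ _ _ h.2.2)

theorem next_congr {x y : G.Cover v₀} {e f : E} (hx : x = y) (he : e = f)
    (h : G.src e = x.proj) (h' : G.src f = y.proj) : x.next e h = y.next f h' := by
  subst hx he; rfl

theorem next_rev_next (x : G.Cover v₀) (e : E) (h : G.src (G.rev e) = x.proj)
    (h' : G.src e = (x.next (G.rev e) h).proj) : (x.next (G.rev e) h).next e h' = x := by
  have h'' : G.src (G.rev (G.rev e)) = (x.next (G.rev e) h).proj := by rw [G.rev_rev]; exact h'
  rw [next_congr rfl (G.rev_rev e).symm h' h'']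
  exact next_next _ _ _ _

/-- Induction along the edges of the universal cover. -/
theorem next_induction {p : G.Cover v₀ → Prop} (h0 : p (root G v₀))
    (h1 : ∀ x e h, p x → p (x.next e h)) (x : G.Cover v₀) : p x := by
  obtain ⟨l, hl⟩ := x
  induction l with
  | nil => exact h0
  | cons e l ih => exact next_init hl ▸ h1 _ _ _ (ih hl.1)

/-- Induction along the edges of the universal cover, starting at an arbitrary vertex. -/
theorem next_induction_from {p : G.Cover v₀ → Prop} (y : G.Cover v₀) (hy : p y)
    (h1 : ∀ x e h, p x → p (x.next e h)) (x : G.Cover v₀) : p x := by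
  refine next_induction ?_ h1 x
  obtain ⟨l, hl⟩ := y
  induction l with
  | nil => exact hy
  | cons e l ih =>
    apply ih hl.1
    have hn : G.src (G.rev e) = ((init hl).next e (src_eq_proj_init hl)).proj := by
      rw [proj_next, G.src_rev]
    have := h1 ((init hl).next e (src_eq_proj_init hl)) (G.rev e) hn (by rw [next_init hl]; exact hy)
    rwa [next_next] at this

/-- A map between universal covers that is compatible with the covering maps and with the lifts
of the edges. -/
structure IsLiftMap {v₁ : V} (φ : G.Cover v₁ → G.Cover v₀) : Prop where
  proj_eq : ∀ z, (φ z).proj = z.proj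
  next_eq : ∀ z e (h : G.src e = z.proj) (h' : G.src e = (φ z).proj),
    φ (z.next e h) = (φ z).next e h'

theorem IsLiftMap.comp {v₁ v₂ : V} {φ : G.Cover v₁ → G.Cover v₀} {ψ : G.Cover v₂ → G.Cover v₁}
    (hφ : IsLiftMap φ) (hψ : IsLiftMap ψ) : IsLiftMap (φ ∘ ψ) where
  proj_eq z := by rw [Function.comp, hφ.proj_eq, hψ.proj_eq]
  next_eq z e h h' := by
    simp only [Function.comp]
    rw [hψ.next_eq z e h (by rw [hψ.proj_eq, h]), hφ.next_eq]

/-- Rigidity of lifts: the image of the root determines the map along every path. -/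
theorem IsLiftMap.eq_id {φ : G.Cover v₀ → G.Cover v₀} (hφ : IsLiftMap φ)
    (h0 : φ (root G v₀) = root G v₀) : φ = id := by
  funext z
  induction z using next_induction with
  | h0 => exact h0
  | h1 x e h ih =>
    rw [hφ.next_eq x e h (by rw [hφ.proj_eq, h])]
    exact next_congr ih rfl _ _

theorem IsLiftMap.surjective {v₁ : V} {φ : G.Cover v₁ → G.Cover v₀} (hφ : IsLiftMap φ) :
    Function.Surjective φ := by
  intro y
  refine next_induction_from (p := fun y => ∃ z, φ z = y) (φ (root G v₁)) ⟨_, rfl⟩ ?_ y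
  rintro _ e h ⟨z, rfl⟩
  exact ⟨z.next e (h.trans (hφ.proj_eq z)), hφ.next_eq z e _ h⟩

open Classical in
/-- The walk from `x` along a path. -/
noncomputable def walk (x : G.Cover v₀) : List E → G.Cover v₀
  | [] => x
  | e :: l => if h : G.src e = (walk x l).proj then (walk x l).next e h else x

/-- On a reduced path that starts at `x.proj` the default branch of `walk` is never taken. -/
theorem proj_walk (x : G.Cover v₀) (l : List E) (hl : G.IsReduced x.proj l) :
    (walk x l).proj = G.endpoint x.proj l := by
  induction l with
  | nil => rfl
  | cons e l ih => rw [walk, dif_pos (hl.2.1.trans (ih hl.1).symm), proj_next]; rfl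

/-- A backtracking step removes the last edge of the path, and walking that edge and then its
reverse returns to the same vertex; otherwise the walk is extended by definition. -/
theorem isLiftMap_walk (x : G.Cover v₀) :
    IsLiftMap (fun z : G.Cover x.proj => walk x z.path) where
  proj_eq z := proj_walk x _ z.reduced
  next_eq z e h h' := by
    by_cases hb : z.path.head? = some (G.rev e)
    · obtain ⟨l, hl⟩ := z
      cases l with
      | nil => simp at hb
      | cons f l =>
        obtain rfl : f = G.rev e := by simpa using hb
        have hf : G.src (G.rev e) = (walk x l).proj := by
          rw [proj_walk x l hl.1]; exact hl.2.1
        have h1 : walk x (G.rev e :: l) = (walk x l).next (G.rev e) hf := by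
          rw [walk, dif_pos hf]
        simp only [next_val_of_back _ _ _ hb, List.tail_cons]
        rw [next_congr h1 rfl h' (h1 ▸ h'), next_rev_next]
    · simp only [next_val_of_forth _ _ _ hb]
      rw [walk, dif_pos h']

/-- Changing the base vertex does not change the cover. Walking from `x`, and walking from a
preimage `y` of the root, give lift maps in opposite directions. One composite fixes the root and is
the identity by rigidity; surjectivity of the second map gives the other composite. -/
theorem exists_liftMap_inverse {v₁ : V} (x : G.Cover v₀) (hx : x.proj = v₁) :
    ∃ (φ : G.Cover v₁ → G.Cover v₀) (ψ : G.Cover v₀ → G.Cover v₁), IsLiftMap φ ∧ IsLiftMap ψ ∧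
      φ (root G v₁) = x ∧ φ ∘ ψ = id ∧ ψ ∘ φ = id := by
  subst hx
  have hφ := isLiftMap_walk x
  obtain ⟨y, hy⟩ := hφ.surjective (root G v₀)
  have hyp : y.proj = v₀ := (hφ.proj_eq y).symm.trans (congrArg proj hy)
  obtain ⟨ψ, hψ, hψ0⟩ : ∃ ψ : G.Cover v₀ → G.Cover x.proj, IsLiftMap ψ ∧ ψ (root G v₀) = y := by
    have key : ∀ v (h : y.proj = v),
        ∃ ψ : G.Cover v → G.Cover x.proj, IsLiftMap ψ ∧ ψ (root G v) = y := by
      rintro _ rfl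
      exact ⟨_, isLiftMap_walk y, rfl⟩
    exact key v₀ hyp
  have h1 : (fun z : G.Cover x.proj => walk x z.path) ∘ ψ = id :=
    (hφ.comp hψ).eq_id (by simp only [Function.comp, hψ0]; exact hy)
  refine ⟨_, ψ, hφ, hψ, rfl, h1, ?_⟩
  funext z
  obtain ⟨u, rfl⟩ := hψ.surjective z
  exact congrArg ψ (congrFun h1 u)

/-- The deck transformations act transitively on the fibres of the covering map. -/
theorem exists_deckTransformation (x y : G.Cover v₀) (h : x.proj = y.proj) :
    ∃ φ : G.Cover v₀ ≃ G.Cover v₀, IsLiftMap φ ∧ φ x = y := by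
  obtain ⟨φ, ψ, hφ, hψ, h0, h1, h2⟩ := exists_liftMap_inverse x h
  obtain ⟨φ', ψ', hφ', hψ', h0', h1', h2'⟩ := exists_liftMap_inverse y rfl
  -- Both `x` and `y` are images of the root of the cover based at their common projection, so the
  -- deck transformation factors through that cover.
  refine ⟨⟨φ' ∘ ψ, φ ∘ ψ', fun z => ?_, fun z => ?_⟩, hφ'.comp hψ, ?_⟩
  · simpa [Function.comp] using
      (congrArg φ (congrFun h2' (ψ z))).trans (congrFun h1 z)
  · simpa [Function.comp] using
      (congrArg φ' (congrFun h2 (ψ' z))).trans (congrFun h1' z)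
  · have : ψ x = root G y.proj := by rw [← h0]; exact congrFun h2 _
    exact (congrArg φ' this).trans h0'

/-! ### Subtrees cut off by one edge -/

/-- The vertices of the universal cover whose path starts with the path `y`. -/
def subtree (y : G.Cover v₀) : Set (G.Cover v₀) := {u | y.path <:+ u.path}

/-- Only removing the last edge of `y` itself can destroy the prefix condition, so the edge between
`x` and `y` is the only exit from the subtree. -/
theorem next_mem_subtree {x y : G.Cover v₀} {e : E} (hy : y.path = e :: x.path)
    {u : G.Cover v₀} (hu : u ∈ subtree y) {f : E} (hf : G.src f = u.proj)
    (h : ¬ (u = y ∧ f = G.rev e)) : u.next f hf ∈ subtree y := by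
  by_cases hb : u.path.head? = some (G.rev f)
  · rw [subtree, Set.mem_ofPred_eq, next_val_of_back _ _ _ hb]
    have hu' : u.path = G.rev f :: u.path.tail := by
      cases hp : u.path with
      | nil => simp [hp] at hb
      | cons g l => simpa [hp] using hb
    rw [subtree, Set.mem_ofPred_eq, hu', List.suffix_cons_iff] at hu
    refine hu.resolve_left fun h1 => h ⟨Cover.ext (hu'.trans h1.symm), ?_⟩
    rw [hy] at h1
    rw [(List.cons.inj h1).1, G.rev_rev]
  · rw [subtree, Set.mem_ofPred_eq, next_val_of_forth _ _ _ hb]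
    exact hu.trans (List.suffix_cons _ _)

theorem not_mem_subtree_init {x y : G.Cover v₀} {e : E} (hy : y.path = e :: x.path) :
    x ∉ subtree y := by
  intro h
  have := h.length_le
  rw [hy] at this
  simp at this

theorem next_not_mem_subtree {x : G.Cover v₀} {e : E} (h : G.src e = x.proj)
    (hy : (x.next e h).path = e :: x.path) {u : G.Cover v₀} (hu : u ∉ subtree (x.next e h)) {f : E}
    (hf : G.src f = u.proj) (hne : ¬ (u = x ∧ f = e)) : u.next f hf ∉ subtree (x.next e h) := by
  intro hm
  have hf' : G.src (G.rev f) = (u.next f hf).proj := by rw [proj_next, G.src_rev]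
  refine hu ?_
  rw [← next_next u f hf hf']
  refine next_mem_subtree hy hm hf' fun hc => hne ?_
  obtain rfl : f = e := by rw [← G.rev_rev f, hc.2, G.rev_rev]
  have he' : G.src (G.rev f) = (x.next f h).proj := by rw [proj_next, G.src_rev]
  exact ⟨by rw [← next_next u f hf hf', ← next_next x f h he', next_congr hc.1 rfl hf' he'], rfl⟩

end MultiGraph.Cover

/-! ### Resolvents of bounded and self-adjoint operators -/

section Resolvent

variable {K : Type*} [NormedAddCommGroup K] [NormedSpace ℂ K]

theorem smul_resolvent_sub {A : K →L[ℂ] K} {z : ℂ} (hz : z ∈ resolventSet ℂ A) (φ : K) :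
    z • resolvent A z φ - A (resolvent A z φ) = φ := by
  have h : (algebraMap ℂ (K →L[ℂ] K) z - A) * resolvent A z = 1 := Ring.mul_inverse_cancel _ hz
  simpa [Algebra.algebraMap_eq_smul_one] using congrArg (fun B : K →L[ℂ] K => B φ) h

theorem eq_resolvent {A : K →L[ℂ] K} {z : ℂ} (hz : z ∈ resolventSet ℂ A) {φ ψ : K}
    (h : z • ψ - A ψ = φ) : ψ = resolvent A z φ := by
  have h' : resolvent A z * (algebraMap ℂ (K →L[ℂ] K) z - A) = 1 := Ring.inverse_mul_cancel _ hz
  have := congrArg (fun B : K →L[ℂ] K => B ψ) h'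
  simp [Algebra.algebraMap_eq_smul_one, h] at this
  exact this.symm

end Resolvent

section SelfAdjoint

variable {K : Type*} [NormedAddCommGroup K] [InnerProductSpace ℂ K] [CompleteSpace K]

theorem IsSelfAdjoint.mem_resolventSet_of_im_ne_zero {A : K →L[ℂ] K} (hA : IsSelfAdjoint A) {z : ℂ}
    (hz : z.im ≠ 0) : z ∈ resolventSet ℂ A := by
  by_contra h
  exact hz (hA.im_eq_zero_of_mem_spectrum h)

theorem IsSelfAdjoint.conj_mem_resolventSet {A : K →L[ℂ] K} (hA : IsSelfAdjoint A) {z : ℂ}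
    (hz : z ∈ resolventSet ℂ A) : star z ∈ resolventSet ℂ A := by
  by_cases h : z.im = 0
  · rwa [show star z = z from Complex.conj_eq_iff_im.2 h]
  · exact hA.mem_resolventSet_of_im_ne_zero (by simpa using h)

theorem IsSelfAdjoint.inner_resolvent {A : K →L[ℂ] K} (hA : IsSelfAdjoint A) {z : ℂ}
    (hz : z ∈ resolventSet ℂ A) (φ ψ : K) :
    inner ℂ (resolvent A z φ) ψ = inner ℂ φ (resolvent A (star z) ψ) := by
  have hz' := hA.conj_mem_resolventSet hz
  conv_lhs => rw [← smul_resolvent_sub hz' ψ]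
  conv_rhs => rw [← smul_resolvent_sub hz φ]
  have hs := hA.isSymmetric (resolvent A z φ) (resolvent A (star z) ψ)
  simp only [ContinuousLinearMap.coe_coe] at hs
  rw [inner_sub_right, inner_sub_left, inner_smul_right, inner_smul_left, hs]
  rfl

/-- The resolvent is a strictly definite form off the real axis. -/
theorem IsSelfAdjoint.inner_resolvent_self_ne_zero {A : K →L[ℂ] K} (hA : IsSelfAdjoint A) {z : ℂ}
    (hz : z.im ≠ 0) {φ : K} (hφ : φ ≠ 0) : inner ℂ φ (resolvent A z φ) ≠ 0 := by
  intro h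
  have hr := hA.mem_resolventSet_of_im_ne_zero hz
  set ψ := resolvent A z φ with hψ
  have h1 : z • ψ - A ψ = φ := smul_resolvent_sub hr φ
  have h2 : inner ℂ ψ φ = 0 := inner_eq_zero_symm.1 h
  -- Since ⟪ψ, A ψ⟫ is real, the imaginary part of ⟪ψ, (z - A) ψ⟫ is (Im z) ‖ψ‖².
  rw [← h1, inner_sub_right, inner_smul_right] at h2
  have h3 : (inner ℂ ψ (A ψ)).im = 0 := by
    have := hA.isSymmetric ψ ψ
    simp only [ContinuousLinearMap.coe_coe] at this
    rw [← Complex.conj_eq_iff_im, inner_conj_symm, this]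
  have h4 := congrArg Complex.im h2
  rw [inner_self_eq_norm_sq_to_K] at h4
  simp only [Complex.coe_algebraMap] at h4
  rw [Complex.sub_im, h3, sub_zero, ← Complex.ofReal_pow, Complex.im_mul_ofReal, Complex.zero_im,
    mul_eq_zero] at h4
  rcases h4 with h4 | h4
  · exact hz h4
  · have h5 : ψ = 0 := by simpa using h4
    rw [h5] at h1
    exact hφ (by simpa using h1.symm)

end SelfAdjoint

namespace EllTwo

variable {X : Type*}

theorem delta_ne_zero (x : X) : delta x ≠ 0 := by
  classical
  intro h
  have := congrArg (fun ψ : EllTwo X => ψ x) h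
  simp [delta_apply] at this

theorem star_delta (x : X) : star (delta x) = delta x := by
  classical
  apply lp.ext
  funext y
  rw [lp.star_apply, delta_apply]
  split_ifs <;> simp

theorem shift_equiv_delta (φ : X ≃ X) (x : X) :
    shift φ.toPEquiv (delta x) = delta (φ.symm x) := by
  classical
  apply lp.ext
  funext y
  rw [shift_apply, Equiv.toPEquiv_apply]
  simp [delta_apply, Equiv.symm_apply_eq]

end EllTwo

/-! ### Symmetries and identities of the Green function -/

namespace JacobiParameters

open MultiGraph Cover EllTwo

variable {V E : Type*} [Fintype V] [Fintype E] {G : MultiGraph V E}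

/-- The matrix is real. This makes the Green function real at real points of the resolvent set and,
with self-adjointness, symmetric. -/
theorem H_star (J : JacobiParameters G) (v₀ : V) (ψ : EllTwo (G.Cover v₀)) :
    J.H v₀ (star ψ) = star (J.H v₀ ψ) := by
  apply lp.ext
  funext x
  rw [lp.star_apply, H_apply, H_apply]
  simp only [lp.star_apply, star_add, star_mul', star_sum, RCLike.star_def, Complex.conj_ofReal]
  congr 1
  refine Finset.sum_congr rfl fun e _ => ?_
  split_ifs <;> simp

theorem commute_shift (J : JacobiParameters G) (v₀ : V) {φ : G.Cover v₀ ≃ G.Cover v₀}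
    (hφ : IsLiftMap φ) : Commute (J.H v₀) (shift φ.toPEquiv) := by
  refine ContinuousLinearMap.ext fun ψ => lp.ext (funext fun x => ?_)
  have h1 : J.H v₀ (shift φ.toPEquiv ψ) x = J.H v₀ ψ (φ x) := by
    rw [H_apply, H_apply]
    congr 1
    · rw [hφ.proj_eq]; rfl
    · refine Finset.sum_congr rfl fun e _ => ?_
      by_cases h : G.src e = x.proj
      · have h' : G.src e = (φ x).proj := by rw [hφ.proj_eq, h]
        rw [dif_pos h, dif_pos h', ← hφ.next_eq x e h h']
        rfl
      · have h' : ¬ G.src e = (φ x).proj := by rwa [hφ.proj_eq]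
        rw [dif_neg h, dif_neg h']
  exact h1

/-- The entry with row `y` and column `x` of the resolvent `(z - H)⁻¹`. -/
noncomputable def green (J : JacobiParameters G) (v₀ : V) (z : ℂ) (x y : G.Cover v₀) : ℂ :=
  resolvent (J.H v₀) z (delta x) y

theorem green_eq_inner (J : JacobiParameters G) (v₀ : V) (z : ℂ) (x y : G.Cover v₀) :
    J.green v₀ z x y = inner ℂ (delta y) (resolvent (J.H v₀) z (delta x)) :=
  (inner_delta_left _ _).symm

theorem star_green (J : JacobiParameters G) {v₀ : V} {z : ℂ} (hz : z ∈ resolventSet ℂ (J.H v₀))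
    (x y : G.Cover v₀) : star (J.green v₀ z x y) = J.green v₀ (star z) x y := by
  have h : star (resolvent (J.H v₀) z (delta x)) = resolvent (J.H v₀) (star z) (delta x) := by
    apply eq_resolvent ((J.isSelfAdjoint_H v₀).conj_mem_resolventSet hz)
    conv_rhs => rw [← star_delta, ← smul_resolvent_sub hz (delta x)]
    rw [H_star, star_sub, star_smul]
  rw [green, green, ← h, lp.star_apply]

theorem green_symm (J : JacobiParameters G) {v₀ : V} {z : ℂ} (hz : z ∈ resolventSet ℂ (J.H v₀))
    (x y : G.Cover v₀) : J.green v₀ z x y = J.green v₀ z y x := by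
  rw [green_eq_inner, ← star_star z,
    ← (J.isSelfAdjoint_H v₀).inner_resolvent ((J.isSelfAdjoint_H v₀).conj_mem_resolventSet hz),
    ← inner_conj_symm, inner_delta_left]
  change star (J.green v₀ (star z) y x) = _
  rw [← J.star_green hz, star_star, star_star]

/-- The translation by a deck transformation commutes with H, hence intertwines the two resolvent
equations. -/
theorem green_deck (J : JacobiParameters G) {v₀ : V} {z : ℂ} (hz : z ∈ resolventSet ℂ (J.H v₀))
    {φ : G.Cover v₀ ≃ G.Cover v₀} (hφ : IsLiftMap φ) (x y : G.Cover v₀) :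
    J.green v₀ z (φ x) (φ y) = J.green v₀ z x y := by
  have h : shift φ.toPEquiv (resolvent (J.H v₀) z (delta (φ x)))
      = resolvent (J.H v₀) z (delta x) := by
    apply eq_resolvent hz
    have hc := congrArg (fun B => B (resolvent (J.H v₀) z (delta (φ x)))) (J.commute_shift v₀ hφ).eq
    simp only [mul_apply_eq_comp] at hc
    rw [hc, ← map_smul, ← map_sub, smul_resolvent_sub hz, shift_equiv_delta, φ.symm_apply_apply]
  rw [green, green, ← h, shift_apply, Equiv.toPEquiv_apply]
  rfl

theorem hasDerivAt_green (J : JacobiParameters G) {v₀ : V} {z : ℂ}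
    (hz : z ∈ resolventSet ℂ (J.H v₀)) (x y : G.Cover v₀) :
    HasDerivAt (fun w => J.green v₀ w x y)
      (-(inner ℂ (delta y) ((resolvent (J.H v₀) z ^ 2) (delta x)))) z := by
  have h1 := spectrum.hasDerivAt_resolvent_const_left hz
  have h2 := h1.clm_apply (hasDerivAt_const z (delta x))
  have h3 := (innerSL ℂ (delta y)).hasFDerivAt.comp_hasDerivAt z h2
  have h4 : (fun w => J.green v₀ w x y)
      = fun w => inner ℂ (delta y) (resolvent (J.H v₀) w (delta x)) :=
    funext fun w => J.green_eq_inner v₀ w x y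
  rw [h4]
  exact h3.congr_deriv (by simp)

open Classical in
theorem green_vertex (J : JacobiParameters G) {v₀ : V} {z : ℂ} (hz : z ∈ resolventSet ℂ (J.H v₀))
    (x : G.Cover v₀) :
    (z - J.b x.proj) * J.green v₀ z x x
      - ∑ e : E, (if h : G.src e = x.proj then J.a e * J.green v₀ z x (x.next e h) else 0) = 1 := by
  have h := congrArg (fun ψ : EllTwo (G.Cover v₀) => ψ x) (smul_resolvent_sub hz (delta x))
  simp only [lp.coeFn_sub, Pi.sub_apply, lp.coeFn_smul, Pi.smul_apply, H_apply, smul_eq_mul,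
    delta_apply, if_true] at h
  rw [← h]
  simp only [green]
  ring

-- The commutator of H with the cut-off to the subtree lives only at the two ends of the cut edge,
-- the sole edge between the subtree and its complement.
open Classical in
theorem H_shift_subtree (J : JacobiParameters G) {v₀ : V} (x : G.Cover v₀) (e : E)
    (h : G.src e = x.proj) (hy : (x.next e h).path = e :: x.path) (ψ : EllTwo (G.Cover v₀))
    (u : G.Cover v₀) :
    J.H v₀ (shift (PEquiv.ofSet (subtree (x.next e h))) ψ) u
      = (if u ∈ subtree (x.next e h) then J.H v₀ ψ u else 0)
        - (if u = x.next e h then J.a e * ψ x else 0)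
        + (if u = x then J.a e * ψ (x.next e h) else 0) := by
  set y := x.next e h with hydef
  set S := subtree y with hS
  have hχ : ∀ w, shift (PEquiv.ofSet S) ψ w = if w ∈ S then ψ w else 0 := by
    intro w
    rw [shift_apply]
    by_cases hw : w ∈ S <;> simp [PEquiv.ofSet, hw]
  have hyS : y ∈ S := List.suffix_rfl
  have hxS : x ∉ S := not_mem_subtree_init hy
  have hsrc : G.src (G.rev e) = y.proj := by rw [proj_next, G.src_rev]
  have hterm : ∀ f : E,
      (if hf : G.src f = u.proj then
          (J.a f : ℂ) * shift (PEquiv.ofSet S) ψ (u.next f hf) else 0)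
        = (if u ∈ S then if hf : G.src f = u.proj then (J.a f : ℂ) * ψ (u.next f hf) else 0 else 0)
          - (if f = G.rev e then if u = y then (J.a e : ℂ) * ψ x else 0 else 0)
          + (if f = e then if u = x then (J.a e : ℂ) * ψ y else 0 else 0) := by
    intro f
    by_cases h1 : u = y ∧ f = G.rev e
    · obtain ⟨rfl, rfl⟩ := h1
      have hux : y ≠ x := next_ne x e h
      rw [dif_pos hsrc, dif_pos hsrc, hχ, next_next x e h hsrc, if_neg hxS, if_pos hyS,
        if_pos rfl, if_pos rfl, if_neg hux, J.a_rev]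
      simp
    by_cases h2 : u = x ∧ f = e
    · obtain ⟨rfl, rfl⟩ := h2
      have hux : u ≠ y := (next_ne u f h).symm
      rw [dif_pos h, hχ, if_pos hyS, if_neg hxS, if_neg hux, if_pos rfl, if_pos rfl,
        ← hydef]
      simp
    have h3 : (if f = G.rev e then if u = y then (J.a e : ℂ) * ψ x else 0 else 0) = 0 := by
      rw [← ite_and, if_neg fun hc => h1 hc.symm]
    have h4 : (if f = e then if u = x then (J.a e : ℂ) * ψ y else 0 else 0) = 0 := by
      rw [← ite_and, if_neg fun hc => h2 hc.symm]
    rw [h3, h4, sub_zero, add_zero]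
    by_cases hf : G.src f = u.proj
    · rw [dif_pos hf, dif_pos hf, hχ]
      by_cases hu : u ∈ S
      · rw [if_pos hu, if_pos (next_mem_subtree hy hu hf h1)]
      · rw [if_neg hu, if_neg (next_not_mem_subtree h hy hu hf h2), mul_zero]
    · simp [hf]
  rw [H_apply, Finset.sum_congr rfl fun f _ => hterm f, Finset.sum_add_distrib,
    Finset.sum_sub_distrib, Finset.sum_ite_eq' Finset.univ, Finset.sum_ite_eq' Finset.univ, hχ,
    H_apply]
  by_cases hu : u ∈ S
  · simp [hu]; ring
  · simp [hu]

/-- This is where the tree structure enters. Restricting the column ψ of the resolvent at `y` to the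
subtree of `y` produces the source (1 + a ψ(x)) δ_y - a ψ(y) δ_x. The restriction vanishes at `x`,
and evaluating there gives the identity. -/
theorem green_edge_of_path_next (J : JacobiParameters G) {v₀ : V} {z : ℂ}
    (hz : z ∈ resolventSet ℂ (J.H v₀)) (x : G.Cover v₀) (e : E) (h : G.src e = x.proj)
    (hy : (x.next e h).path = e :: x.path) :
    J.a e * (J.green v₀ z x x * J.green v₀ z (x.next e h) (x.next e h))
      = J.green v₀ z x (x.next e h) * (1 + J.a e * J.green v₀ z x (x.next e h)) := by
  classical
  rw [J.green_symm hz x (x.next e h)]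
  set y := x.next e h with hydef
  set ψ := resolvent (J.H v₀) z (delta y) with hψ
  have hψz : z • ψ - J.H v₀ ψ = delta y := smul_resolvent_sub hz _
  have hyS : y ∈ subtree y := List.suffix_rfl
  have hxS : x ∉ subtree y := not_mem_subtree_init hy
  have hxy : y ≠ x := next_ne x e h
  have hχ : ∀ w, shift (PEquiv.ofSet (subtree y)) ψ w = if w ∈ subtree y then ψ w else 0 := by
    intro w
    rw [shift_apply]
    by_cases hw : w ∈ subtree y <;> simp [PEquiv.ofSet, hw]
  have key : shift (PEquiv.ofSet (subtree y)) ψ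
      = resolvent (J.H v₀) z ((1 + J.a e * ψ x) • delta y - (J.a e * ψ y) • delta x) := by
    apply eq_resolvent hz
    apply lp.ext
    funext u
    have hu := congrArg (fun φ : EllTwo (G.Cover v₀) => φ u) hψz
    simp only [lp.coeFn_sub, Pi.sub_apply, lp.coeFn_smul, Pi.smul_apply, smul_eq_mul] at hu ⊢
    rw [J.H_shift_subtree x e h hy ψ u, ← hydef, hχ]
    rw [delta_apply] at hu ⊢
    rw [delta_apply]
    by_cases h1 : u = y
    · subst h1
      simp only [hyS, hxy, hxy.symm, if_true, if_false] at hu ⊢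
      linear_combination hu
    · by_cases h2 : u = x
      · subst h2
        simp only [hxS, h1, hxy, if_true, if_false] at hu ⊢
        ring
      · rw [if_neg (Ne.symm h1)] at hu ⊢
        rw [if_neg (Ne.symm h2), if_neg h1, if_neg h2]
        by_cases h3 : u ∈ subtree y
        · rw [if_pos h3, if_pos h3]
          linear_combination hu
        · rw [if_neg h3, if_neg h3]
          ring
  have hx := congrArg (fun φ : EllTwo (G.Cover v₀) => φ x) key
  simp only [map_sub, map_smul, lp.coeFn_sub, Pi.sub_apply, lp.coeFn_smul, Pi.smul_apply,
    smul_eq_mul] at hx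
  rw [hχ, if_neg hxS] at hx
  simp only [green]
  rw [← hψ]
  linear_combination hx

theorem green_edge (J : JacobiParameters G) {v₀ : V} {z : ℂ}
    (hz : z ∈ resolventSet ℂ (J.H v₀)) (x : G.Cover v₀) (e : E) (h : G.src e = x.proj) :
    J.a e * (J.green v₀ z x x * J.green v₀ z (x.next e h) (x.next e h))
      = J.green v₀ z x (x.next e h) * (1 + J.a e * J.green v₀ z x (x.next e h)) := by
  by_cases hb : x.path.head? = some (G.rev e)
  · have hs : G.src (G.rev e) = (x.next e h).proj := by rw [proj_next, G.src_rev]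
    have hx : (x.next e h).next (G.rev e) hs = x := next_next x e h hs
    have hp : ((x.next e h).next (G.rev e) hs).path = G.rev e :: (x.next e h).path := by
      rw [hx, next_val_of_back _ _ _ hb]
      cases hp : x.path with
      | nil => simp [hp] at hb
      | cons g l => simpa [hp] using hb
    have := J.green_edge_of_path_next hz (x.next e h) (G.rev e) hs hp
    rw [hx, J.a_rev] at this
    rw [J.green_symm hz x (x.next e h), ← this]
    ring
  · exact J.green_edge_of_path_next hz x e h (next_val_of_forth _ _ _ hb)

end JacobiParameters

/-! ### The algebra of the logarithmic derivative -/

namespace MultiGraph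

/-- There is a set of edges that contains one of the two orientations of every edge. -/
theorem exists_orientation {V E : Type*} [Fintype E] (G : MultiGraph V E) :
    ∃ O : Finset E, ∀ f : E → ℂ, ∑ e, f e = ∑ e ∈ O, (f e + f (G.rev e)) := by
  classical
  -- An arbitrary enumeration breaks the tie between `e` and `rev e`, which differ even for a loop.
  let r : E ≃ Fin (Fintype.card E) := Fintype.equivFin E
  refine ⟨Finset.univ.filter fun e => r e < r (G.rev e), fun f => ?_⟩
  rw [Finset.sum_add_distrib, ← Finset.sum_filter_add_sum_filter_not Finset.univ
    (fun e => r e < r (G.rev e)) f]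
  congr 1
  refine Finset.sum_nbij' G.rev G.rev ?_ ?_ (by simp [G.rev_rev]) (by simp [G.rev_rev])
    (by simp [G.rev_rev])
  · intro e he
    simp only [Finset.mem_filter, Finset.mem_univ, true_and, not_lt, G.rev_rev] at he ⊢
    exact lt_of_le_of_ne he fun h => G.rev_ne e (r.injective h)
  · intro e he
    simp only [Finset.mem_filter, Finset.mem_univ, true_and, not_lt, G.rev_rev] at he ⊢
    exact he.le

open Classical in
/-- The logarithmic derivative of `∏ (1 + a t) / ∏ s` for quantities that satisfy the equations of
the Green function of a tree. -/
theorem sum_logDeriv_eq {V E : Type*} [Fintype V] [Fintype E] (G : MultiGraph V E) {O : Finset E}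
    (hO : ∀ f : E → ℂ, ∑ e, f e = ∑ e ∈ O, (f e + f (G.rev e)))
    (a t t' : E → ℂ) (c s s' : V → ℂ) (ha : ∀ e, a (G.rev e) = a e) (ha0 : ∀ e, a e ≠ 0)
    (ht : ∀ e, t (G.rev e) = t e) (ht' : ∀ e, t' (G.rev e) = t' e) (hs : ∀ v, s v ≠ 0)
    (hv : ∀ v, c v * s v - ∑ e, (if G.src e = v then a e * t e else 0) = 1)
    (hv' : ∀ v, s v + c v * s' v - ∑ e, (if G.src e = v then a e * t' e else 0) = 0)
    (he : ∀ e, a e * (s (G.src e) * s (G.tgt e)) = t e * (1 + a e * t e))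
    (he' : ∀ e, a e * (s' (G.src e) * s (G.tgt e) + s (G.src e) * s' (G.tgt e))
      = t' e * (1 + 2 * a e * t e)) :
    ∑ e ∈ O, a e * t' e / (1 + a e * t e) - ∑ v, s' v / s v = ∑ v, s v := by
  -- The differentiated vertex equation minus s'/s times the vertex equation: the coefficient `c`
  -- cancels.
  have h1 : ∀ v, s v = -(s' v / s v) +
      ∑ e, (if G.src e = v then a e * (t' e - t e * (s' v / s v)) else 0) := by
    intro v
    have hsum : ∑ e, (if G.src e = v then a e * (t' e - t e * (s' v / s v)) else 0)
        = ∑ e, (if G.src e = v then a e * t' e else 0)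
          - (∑ e, (if G.src e = v then a e * t e else 0)) * (s' v / s v) := by
      rw [Finset.sum_mul, ← Finset.sum_sub_distrib]
      refine Finset.sum_congr rfl fun e _ => ?_
      split_ifs <;> ring
    rw [hsum]
    have h2 : s v * (s' v / s v) = s' v := mul_div_cancel₀ _ (hs v)
    linear_combination hv' v - (s' v / s v) * hv v + c v * h2
  have h2 : ∑ v, ∑ e, (if G.src e = v then a e * (t' e - t e * (s' v / s v)) else 0)
      = ∑ e, a e * (t' e - t e * (s' (G.src e) / s (G.src e))) := by
    rw [Finset.sum_comm]
    refine Finset.sum_congr rfl fun e _ => ?_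
    rw [Finset.sum_ite_eq Finset.univ]
    simp
  rw [Finset.sum_congr rfl fun v _ => h1 v, Finset.sum_add_distrib, h2, hO, Finset.sum_neg_distrib,
    sub_eq_add_neg, add_comm]
  congr 1
  refine Finset.sum_congr rfl fun e _ => ?_
  rw [ha, ht, ht', G.src_rev]
  have hne : t e * (1 + a e * t e) ≠ 0 := by
    rw [← he e]
    exact mul_ne_zero (ha0 e) (mul_ne_zero (hs _) (hs _))
  have hne1 := left_ne_zero_of_mul hne
  have hne2 := right_ne_zero_of_mul hne
  -- The logarithmic derivative of the edge equation. The two orientations of an edge together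
  -- contribute a (2t' - t (s'/s + s'/s)), with s'/s taken at each end; by this relation it equals a
  -- t' / (1 + a t).
  have h3 : t e * (1 + a e * t e) * (s' (G.src e) / s (G.src e) + s' (G.tgt e) / s (G.tgt e))
      = t' e * (1 + 2 * a e * t e) := by
    rw [← he e, ← he' e]
    have := hs (G.src e)
    have := hs (G.tgt e)
    field_simp
  rw [div_eq_iff hne2]
  linear_combination a e * h3

end MultiGraph

/-! ### The Green function on the finite graph -/

namespace JacobiParameters

open MultiGraph Cover EllTwo

variable {V E : Type*} [Fintype V] [Fintype E] {G : MultiGraph V E}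

theorem green_eq_of_proj_eq (J : JacobiParameters G) {v₀ : V} {z : ℂ}
    (hz : z ∈ resolventSet ℂ (J.H v₀)) {x y : G.Cover v₀} (h : x.proj = y.proj) :
    J.green v₀ z x x = J.green v₀ z y y := by
  obtain ⟨φ, hφ, rfl⟩ := exists_deckTransformation x y h
  rw [J.green_deck hz hφ]

theorem green_next_eq_of_proj_eq (J : JacobiParameters G) {v₀ : V} {z : ℂ}
    (hz : z ∈ resolventSet ℂ (J.H v₀)) {x y : G.Cover v₀} {e : E} (hx : G.src e = x.proj)
    (hy : G.src e = y.proj) :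
    J.green v₀ z x (x.next e hx) = J.green v₀ z y (y.next e hy) := by
  obtain ⟨φ, hφ, rfl⟩ := exists_deckTransformation x y (hx.symm.trans hy)
  rw [← hφ.next_eq x e hx hy, J.green_deck hz hφ]

/-- The diagonal entry of the resolvent at the vertices over `v`. -/
noncomputable def vertexGreen (J : JacobiParameters G) {v₀ : V} (lift : V → G.Cover v₀) (v : V)
    (z : ℂ) : ℂ := J.green v₀ z (lift v) (lift v)

/-- The entry of the resolvent for the end points of the lifts of `e`. -/
noncomputable def edgeGreen (J : JacobiParameters G) {v₀ : V} {lift : V → G.Cover v₀}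
    (hlift : ∀ v, (lift v).proj = v) (e : E) (z : ℂ) : ℂ :=
  J.green v₀ z (lift (G.src e)) ((lift (G.src e)).next e (hlift _).symm)

variable (J : JacobiParameters G) {v₀ : V} {lift : V → G.Cover v₀}
  (hlift : ∀ v, (lift v).proj = v) {z : ℂ} (hz : z ∈ resolventSet ℂ (J.H v₀))

include hz

open Classical in
include hlift in
theorem vertexGreen_equation (v : V) :
    (z - J.b v) * J.vertexGreen lift v z
      - ∑ e : E, (if G.src e = v then J.a e * J.edgeGreen hlift e z else 0) = 1 := by
  have h := J.green_vertex hz (lift v)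
  have hb : J.b (lift v).proj = J.b v := by rw [hlift v]
  rw [hb] at h
  rw [vertexGreen, ← h]
  congr 1
  refine Finset.sum_congr rfl fun e _ => ?_
  by_cases he : G.src e = v
  · have he' : G.src e = (lift v).proj := he.trans (hlift v).symm
    rw [if_pos he, dif_pos he', edgeGreen,
      J.green_next_eq_of_proj_eq hz (hlift (G.src e)).symm he']
  · have he' : ¬ G.src e = (lift v).proj := by rwa [hlift v]
    rw [if_neg he, dif_neg he']

theorem edgeGreen_equation (e : E) :
    J.a e * (J.vertexGreen lift (G.src e) z * J.vertexGreen lift (G.tgt e) z)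
      = J.edgeGreen hlift e z * (1 + J.a e * J.edgeGreen hlift e z) := by
  have h := J.green_edge hz (lift (G.src e)) e (hlift _).symm
  rwa [J.green_eq_of_proj_eq hz (x := (lift (G.src e)).next e (hlift _).symm)
    (y := lift (G.tgt e)) (by rw [proj_next, hlift])] at h

theorem edgeGreen_rev (e : E) : J.edgeGreen hlift (G.rev e) z = J.edgeGreen hlift e z := by
  have h : G.src (G.rev e) = ((lift (G.src e)).next e (hlift _).symm).proj := by
    rw [proj_next, G.src_rev]
  rw [edgeGreen, J.green_next_eq_of_proj_eq hz (hlift (G.src (G.rev e))).symm h, next_next,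
    J.green_symm hz]
  rfl

theorem differentiableAt_vertexGreen (v : V) : DifferentiableAt ℂ (J.vertexGreen lift v) z :=
  (J.hasDerivAt_green hz _ _).differentiableAt

theorem differentiableAt_edgeGreen (e : E) : DifferentiableAt ℂ (J.edgeGreen hlift e) z :=
  (J.hasDerivAt_green hz _ _).differentiableAt

/-- The edge equation makes this a factor of a nonzero number. -/
theorem edgeGreen_factor_ne_zero (h0 : ∀ v, J.vertexGreen lift v z ≠ 0) (e : E) :
    1 + J.a e * J.edgeGreen hlift e z ≠ 0 := by
  refine right_ne_zero_of_mul (a := J.edgeGreen hlift e z) ?_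
  rw [← J.edgeGreen_equation hlift hz]
  exact mul_ne_zero (by simpa using (J.a_pos e).ne') (mul_ne_zero (h0 _) (h0 _))

theorem logDeriv_greenQuotient {O : Finset E}
    (hO : ∀ f : E → ℂ, ∑ e, f e = ∑ e ∈ O, (f e + f (G.rev e)))
    (h0 : ∀ v, J.vertexGreen lift v z ≠ 0) :
    logDeriv (fun w => (∏ e ∈ O, (1 + J.a e * J.edgeGreen hlift e w))
      / ∏ v, J.vertexGreen lift v w) z = ∑ v, J.vertexGreen lift v z := by
  classical
  have hds := fun v => J.differentiableAt_vertexGreen (lift := lift) hz v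
  have hdt := fun e => J.differentiableAt_edgeGreen hlift hz e
  have hd1 : ∀ e, DifferentiableAt ℂ (fun w => 1 + J.a e * J.edgeGreen hlift e w) z :=
    fun e => (((hdt e).const_mul _).const_add _)
  have h1 := fun e => J.edgeGreen_factor_ne_zero hlift hz h0 e
  -- The vertex, edge and reversal identities hold on the open resolvent set, so they may be
  -- differentiated at `z`.
  have hev : ∀ᶠ w in nhds z, w ∈ resolventSet ℂ (J.H v₀) :=
    (spectrum.isOpen_resolventSet _).mem_nhds hz
  rw [logDeriv_div z (Finset.prod_ne_zero_iff.2 fun e _ => h1 e)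
    (Finset.prod_ne_zero_iff.2 fun v _ => h0 v) (.fun_finsetProd fun e _ => hd1 e)
    (.fun_finsetProd fun v _ => hds v), logDeriv_prod (fun e _ => h1 e) (fun e _ => hd1 e),
    logDeriv_prod (fun v _ => h0 v) (fun v _ => hds v)]
  have hd2 : ∀ e, logDeriv (fun w => 1 + J.a e * J.edgeGreen hlift e w) z
      = J.a e * deriv (J.edgeGreen hlift e) z / (1 + J.a e * J.edgeGreen hlift e z) := by
    intro e
    rw [logDeriv_apply, deriv_const_add, deriv_const_mul _ (hdt e)]
  simp only [hd2]
  refine G.sum_logDeriv_eq hO (fun e => J.a e) (fun e => J.edgeGreen hlift e z)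
    (fun e => deriv (J.edgeGreen hlift e) z) (fun v => z - J.b v)
    (fun v => J.vertexGreen lift v z) (fun v => deriv (J.vertexGreen lift v) z)
    (fun e => by rw [J.a_rev]) (fun e => by simpa using (J.a_pos e).ne')
    (fun e => J.edgeGreen_rev hlift hz e) ?_ h0 (fun v => J.vertexGreen_equation hlift hz v)
    ?_ (fun e => J.edgeGreen_equation hlift hz e) ?_
  · intro e
    exact Filter.EventuallyEq.deriv_eq (hev.mono fun w hw => J.edgeGreen_rev hlift hw e)
  · intro v
    have hl : HasDerivAt (fun w => (w - J.b v) * J.vertexGreen lift v w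
        - ∑ e : E, (if G.src e = v then (J.a e : ℂ) else 0) * J.edgeGreen hlift e w)
        (1 * J.vertexGreen lift v z + (z - J.b v) * deriv (J.vertexGreen lift v) z
          - ∑ e : E, (if G.src e = v then (J.a e : ℂ) else 0) * deriv (J.edgeGreen hlift e) z) z :=
      (((hasDerivAt_id z).sub_const _).mul (hds v).hasDerivAt).sub
        (HasDerivAt.fun_sum fun e _ => (hdt e).hasDerivAt.const_mul _)
    have hr : HasDerivAt (fun w => (w - J.b v) * J.vertexGreen lift v w
        - ∑ e : E, (if G.src e = v then (J.a e : ℂ) else 0) * J.edgeGreen hlift e w) 0 z := by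
      refine (hasDerivAt_const z (1 : ℂ)).congr_of_eventuallyEq (hev.mono fun w hw => ?_)
      simpa only [ite_mul, zero_mul] using J.vertexGreen_equation hlift hw v
    have := hl.unique hr
    simpa only [ite_mul, zero_mul, one_mul] using this
  · intro e
    have hl : HasDerivAt
        (fun w => J.a e * (J.vertexGreen lift (G.src e) w * J.vertexGreen lift (G.tgt e) w)) _ z :=
      ((hds (G.src e)).hasDerivAt.mul (hds (G.tgt e)).hasDerivAt).const_mul _
    have hr : HasDerivAt
        (fun w => J.edgeGreen hlift e w * (1 + J.a e * J.edgeGreen hlift e w)) _ z :=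
      (hdt e).hasDerivAt.mul (((hdt e).hasDerivAt.const_mul _).const_add _)
    have := hl.unique (hr.congr_of_eventuallyEq
      (hev.mono fun w hw => J.edgeGreen_equation hlift hw e))
    linear_combination this

end JacobiParameters

/-! ### Spectral measures and their Stieltjes transforms -/

section SpectralMeasure

open MeasureTheory

variable {K : Type*} [NormedAddCommGroup K] [InnerProductSpace ℂ K] [CompleteSpace K]

instance spectralMeasure_regular (A : K →L[ℂ] K) (φ : K) : (spectralMeasure A φ).Regular :=
  RealRMK.regular_rieszMeasure _

omit [CompleteSpace K] in
theorem ofReal_mem_spectrum_iff {A : K →L[ℂ] K} {t : ℝ} :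
    (t : ℂ) ∈ spectrum ℂ A ↔ t ∈ spectrum ℝ A :=
  spectrum.algebraMap_mem_iff (S := ℂ) (r := t)

/-- By inner regularity it suffices to treat a compact set off the spectrum. An Urysohn function
that is 1 there and 0 on the spectrum has zero functional calculus, and its integral bounds the
measure of the compact set. -/
theorem spectralMeasure_compl_spectrum (A : K →L[ℂ] K) (φ : K) :
    spectralMeasure A φ (spectrum ℝ A)ᶜ = 0 := by
  have ho : IsOpen (spectrum ℝ A)ᶜ := (spectrum.isClosed A).isOpen_compl
  rw [ho.measure_eq_iSup_isCompact]
  simp only [ENNReal.iSup_eq_zero]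
  intro C hC hCc
  obtain ⟨f, hf1, hf0, hfc, hf01⟩ := exists_continuous_one_zero_of_isCompact hCc
    (spectrum.isClosed (𝕜 := ℝ) A) (Set.disjoint_left.2 fun t ht h => hC ht h)
  let g : C_c(ℝ, ℝ) := ⟨f, hfc⟩
  have hg : cfc (g : ℝ → ℝ) A = 0 := by
    have h : cfc (g : ℝ → ℝ) A = cfc (fun _ : ℝ => (0 : ℝ)) A :=
      cfc_congr fun t ht => hf0 ht
    rw [h, cfc_const_zero ℝ A]
  have h := RealRMK.rieszMeasure_le_of_eq_one (spectralFunctional A φ) (f := g)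
    (fun t => (hf01 t).1) hCc (fun t ht => hf1 ht)
  have h0 : spectralFunctional A φ g = 0 := by
    change (inner ℂ φ (cfc (g : ℝ → ℝ) A φ)).re = 0
    simp [hg]
  rw [h0, ENNReal.ofReal_zero] at h
  exact le_antisymm h zero_le

theorem ae_mem_spectrum (A : K →L[ℂ] K) (φ : K) :
    ∀ᵐ t ∂(spectralMeasure A φ), t ∈ spectrum ℝ A :=
  spectralMeasure_compl_spectrum A φ

instance isFiniteMeasure_spectralMeasure (A : K →L[ℂ] K) (φ : K) :
    IsFiniteMeasure (spectralMeasure A φ) where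
  measure_univ_lt_top := by
    rw [← Set.union_compl_self (spectrum ℝ A)]
    refine (measure_union_le _ _).trans_lt ?_
    rw [spectralMeasure_compl_spectrum, add_zero]
    exact (spectrum.isCompact (𝕜 := ℝ) A).measure_lt_top

theorem integrable_spectralMeasure (A : K →L[ℂ] K) (φ : K) {F : Type*} [NormedAddCommGroup F]
    {f : ℝ → F} (hf : Continuous f) :
    Integrable f (spectralMeasure A φ) := by
  obtain ⟨C, hC⟩ := (spectrum.isCompact (𝕜 := ℝ) A).exists_bound_of_continuousOn hf.continuousOn
  exact Integrable.of_bound hf.aestronglyMeasurable C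
    ((ae_mem_spectrum A φ).mono fun t ht => hC t ht)

theorem integral_spectralMeasure_of_continuous (A : K →L[ℂ] K) (φ : K) {f : ℝ → ℝ}
    (hf : Continuous f) :
    ∫ t, f t ∂(spectralMeasure A φ) = (inner ℂ φ (cfc f A φ)).re := by
  -- A cut-off equal to 1 on the compact spectrum changes neither the integral nor the functional
  -- calculus.
  obtain ⟨χ, h1, -, hc, -⟩ := exists_continuous_one_zero_of_isCompact
    (spectrum.isCompact (𝕜 := ℝ) A) isClosed_empty (Set.disjoint_empty _)
  let g : C_c(ℝ, ℝ) := ⟨⟨fun t => χ t * f t, χ.continuous.mul hf⟩, hc.mul_right⟩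
  have hg : ∀ t ∈ spectrum ℝ A, f t = g t := fun t ht => by
    change f t = χ t * f t
    rw [h1 ht, Pi.one_apply, one_mul]
  rw [integral_congr_ae ((ae_mem_spectrum A φ).mono hg), cfc_congr hg]
  exact integral_spectralMeasure A φ g

theorem isProbabilityMeasure_spectralMeasure {A : K →L[ℂ] K} (hA : IsSelfAdjoint A) {φ : K}
    (hφ : ‖φ‖ = 1) : IsProbabilityMeasure (spectralMeasure A φ) where
  measure_univ := by
    have h := integral_spectralMeasure_of_continuous A φ (f := fun _ => 1) continuous_const
    rw [cfc_const_one ℝ A, one_apply_eq_self, inner_self_eq_norm_sq_to_K, hφ] at h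
    simp only [integral_const, smul_eq_mul, mul_one] at h
    have h' : (spectralMeasure A φ).real Set.univ = 1 := by rw [h]; simp
    rwa [measureReal_def, ENNReal.toReal_eq_one_iff] at h'

theorem im_inner_cfc_self (A : K →L[ℂ] K) (φ : K) (f : ℝ → ℝ) :
    (inner ℂ φ (cfc f A φ)).im = 0 := by
  have h := (cfc_predicate f A : IsSelfAdjoint (cfc f A)).isSymmetric φ φ
  simp only [ContinuousLinearMap.coe_coe] at h
  rw [← Complex.conj_eq_iff_im, inner_conj_symm, h]

/-- The Stieltjes transform of the spectral measure is the diagonal entry of the resolvent. -/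
theorem inner_resolvent_eq_integral {A : K →L[ℂ] K} (hA : IsSelfAdjoint A) (φ : K) {z : ℂ}
    (hz : z.im ≠ 0) :
    inner ℂ φ (resolvent A z φ) = ∫ t : ℝ, (z - t)⁻¹ ∂(spectralMeasure A φ) := by
  -- The functional calculus in use is for real functions, so 1/(z - t) is split into its real part
  -- `u` and imaginary part `v`.
  set d : ℝ → ℝ := fun t => (z.re - t) ^ 2 + z.im ^ 2 with hd
  have hd0 : ∀ t, d t ≠ 0 := fun t => by positivity
  set u : ℝ → ℝ := fun t => (z.re - t) / d t with hu
  set v : ℝ → ℝ := fun t => - z.im / d t with hv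
  have hdc : Continuous d := by fun_prop
  have huc : Continuous u := (continuous_const.sub continuous_id).div hdc hd0
  have hvc : Continuous v := continuous_const.div hdc hd0
  have hinv : ∀ t : ℝ, (z - t)⁻¹ = (u t : ℂ) + (v t : ℂ) * Complex.I := by
    intro t
    have hn : Complex.normSq (z - t) = d t := by
      rw [Complex.normSq_apply]; simp [hd]; ring
    apply Complex.ext
    · simp [Complex.inv_re, hn, hu]
    · simp [Complex.inv_im, hn, hv]
  have hlin : cfc (fun t : ℝ => z.re - t) A = (z.re : ℂ) • 1 - A := by
    rw [cfc_sub (a := A) (fun _ => z.re) (fun t => t), cfc_const z.re A, cfc_id' ℝ A]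
    rfl
  have e1 : cfc (fun t : ℝ => z.re - t) A * cfc u A = cfc (fun t => (z.re - t) * u t) A :=
    (cfc_mul _ _ A (by fun_prop) huc.continuousOn).symm
  have e2 : cfc (fun t : ℝ => z.re - t) A * cfc v A = cfc (fun t => (z.re - t) * v t) A :=
    (cfc_mul _ _ A (by fun_prop) hvc.continuousOn).symm
  have e3 : cfc (fun t => (z.re - t) * u t) A = 1 + (z.im : ℂ) • cfc v A := by
    have : (z.im : ℂ) • cfc v A = cfc (fun t => z.im * v t) A := by
      rw [cfc_const_mul z.im v A hvc.continuousOn]; rfl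
    rw [this, ← cfc_const_one ℝ A, ← cfc_add (a := A) (fun _ => 1) (fun t => z.im * v t)
      (by fun_prop) (by fun_prop)]
    refine cfc_congr fun t _ => ?_
    simp only [hu, hv]
    have := hd0 t
    field_simp
    simp only [hd]; ring
  have e4 : cfc (fun t => (z.re - t) * v t) A = -((z.im : ℂ) • cfc u A) := by
    have : (z.im : ℂ) • cfc u A = cfc (fun t => z.im * u t) A := by
      rw [cfc_const_mul z.im u A huc.continuousOn]; rfl
    rw [this, ← cfc_neg]
    refine cfc_congr fun t _ => ?_
    simp only [hu, hv]
    ring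
  -- With y = Im z, the relations (Re z - t) u = 1 + y v and (Re z - t) v = -y u say that u(A) + i
  -- v(A) inverts z - A.
  have hB : cfc u A φ + Complex.I • cfc v A φ = resolvent A z φ := by
    apply eq_resolvent (hA.mem_resolventSet_of_im_ne_zero hz)
    have f1 := congrArg (fun B : K →L[ℂ] K => B φ) (e1.trans e3)
    have f2 := congrArg (fun B : K →L[ℂ] K => B φ) (e2.trans e4)
    rw [hlin] at f1 f2
    simp only [mul_apply_eq_comp, sub_apply, smul_apply, one_apply_eq_self, add_apply,
      neg_apply] at f1 f2
    rw [map_add, map_smul]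
    rw [sub_eq_iff_eq_add] at f1 f2
    conv_lhs => rw [← Complex.re_add_im z]
    rw [add_smul, smul_add, smul_add, f1]
    have hI : ((z.im : ℂ) * Complex.I) • Complex.I • cfc v A φ = -((z.im : ℂ) • cfc v A φ) := by
      rw [smul_smul, mul_assoc, Complex.I_mul_I]
      module
    rw [smul_comm (z.re : ℂ), f2, hI]
    module
  have hr : ∀ f : ℝ → ℝ, Continuous f →
      inner ℂ φ (cfc f A φ) = ((∫ t, f t ∂(spectralMeasure A φ) : ℝ) : ℂ) := by
    intro f hf
    rw [integral_spectralMeasure_of_continuous A φ hf]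
    exact Complex.ext rfl (by rw [im_inner_cfc_self, Complex.ofReal_im])
  simp only [hinv]
  rw [← hB, inner_add_right, inner_smul_right, hr u huc, hr v hvc, integral_add, integral_mul_const,
    integral_complex_ofReal, integral_complex_ofReal, mul_comm]
  · exact integrable_spectralMeasure A φ (by fun_prop)
  · exact integrable_spectralMeasure A φ (by fun_prop)

end SpectralMeasure

/-! ### The logarithmic potential and its boundary phase -/

section LogPotential

open MeasureTheory Filter Topology

variable {K : Type*} [NormedAddCommGroup K] [InnerProductSpace ℂ K] [CompleteSpace K]

/-- For Im w > 0 the numbers `w - t` avoid the branch cut. Where Im w > Im z / 2, the derivative of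
the integrand is at most 2 / Im z, so differentiation under the integral is allowed. -/
theorem hasDerivAt_integral_log (A : K →L[ℂ] K) (φ : K) {z : ℂ} (hz : 0 < z.im) :
    HasDerivAt (fun w => ∫ t : ℝ, Complex.log (w - t) ∂(spectralMeasure A φ))
      (∫ t : ℝ, (z - t)⁻¹ ∂(spectralMeasure A φ)) z := by
  have hslit : ∀ w : ℂ, 0 < w.im → ∀ t : ℝ, w - t ∈ Complex.slitPlane := fun w hw t =>
    Or.inr (by simpa using hw.ne')
  have hcont : ∀ w : ℂ, 0 < w.im → Continuous fun t : ℝ => Complex.log (w - t) := fun w hw =>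
    (continuous_const.sub Complex.continuous_ofReal).clog (hslit w hw)
  have hinv : Continuous fun t : ℝ => (z - t)⁻¹ :=
    (continuous_const.sub Complex.continuous_ofReal).inv₀
      fun t => Complex.slitPlane_ne_zero (hslit z hz t)
  have hs : {w : ℂ | z.im / 2 < w.im} ∈ 𝓝 z :=
    (isOpen_lt continuous_const Complex.continuous_im).mem_nhds (by
      change z.im / 2 < z.im
      linarith)
  refine (hasDerivAt_integral_of_dominated_loc_of_deriv_le (F := fun w (t : ℝ) => Complex.log (w - t))
    (F' := fun w (t : ℝ) => (w - t)⁻¹) (bound := fun _ => 2 / z.im) hs ?_ ?_ ?_ ?_ ?_ ?_).2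
  · filter_upwards [hs] with w hw
    have hw' : z.im / 2 < w.im := hw
    exact (hcont w (by linarith)).aestronglyMeasurable
  · exact integrable_spectralMeasure A φ (hcont z hz)
  · exact hinv.aestronglyMeasurable
  · refine Eventually.of_forall fun t w hw => ?_
    have hw' : z.im / 2 < w.im := hw
    have h1 : w.im ≤ ‖w - t‖ := by
      have := Complex.abs_im_le_norm (w - t)
      simp only [Complex.sub_im, Complex.ofReal_im, sub_zero] at this
      exact (le_abs_self _).trans this
    rw [norm_inv, inv_le_comm₀ (by linarith) (by positivity), inv_div]
    linarith
  · exact integrable_const _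
  · refine Eventually.of_forall fun t w hw => ?_
    have hw' : z.im / 2 < w.im := hw
    simpa using ((hasDerivAt_id w).sub_const (t : ℂ)).clog (hslit w (by linarith) t)

theorem im_integral_log (A : K →L[ℂ] K) (φ : K) {z : ℂ} (hz : 0 < z.im) :
    (∫ t : ℝ, Complex.log (z - t) ∂(spectralMeasure A φ)).im
      = ∫ t : ℝ, Complex.arg (z - t) ∂(spectralMeasure A φ) := by
  have hcont : Continuous fun t : ℝ => Complex.log (z - t) :=
    (continuous_const.sub Complex.continuous_ofReal).clog
      fun t => Or.inr (by simpa using hz.ne')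
  have h := integral_im (𝕜 := ℂ) (integrable_spectralMeasure A φ hcont)
  simpa [Complex.log_im] using h.symm

theorem integral_arg_sub (μ : Measure ℝ) (x : ℝ) :
    ∫ t : ℝ, Complex.arg ((x : ℂ) - t) ∂μ = Real.pi * μ.real (Set.Ioi x) := by
  have h : (fun t : ℝ => Complex.arg ((x : ℂ) - t))
      = (Set.Ioi x).indicator fun _ => Real.pi := by
    funext t
    rw [← Complex.ofReal_sub]
    -- The convention `arg 0 = 0` puts `t = x` with the points of argument 0, which is why the ray
    -- is open.
    by_cases ht : x < t
    · rw [Set.indicator_of_mem (Set.mem_Ioi.2 ht), Complex.arg_ofReal_of_neg (by linarith)]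
    · rw [Set.indicator_of_notMem (by simpa using ht), Complex.arg_ofReal_of_nonneg (by linarith)]
  rw [h, integral_indicator_const _ measurableSet_Ioi, smul_eq_mul, mul_comm]

theorem tendsto_integral_arg (A : K →L[ℂ] K) (φ : K) {x : ℝ} (hx : x ∉ spectrum ℝ A) :
    Tendsto (fun ε : ℝ => ∫ t : ℝ, Complex.arg ((x : ℂ) + ε * Complex.I - t)
      ∂(spectralMeasure A φ)) (𝓝[>] 0)
      (𝓝 (Real.pi * (spectralMeasure A φ).real (Set.Ioi x))) := by
  rw [← integral_arg_sub]
  refine tendsto_integral_filter_of_dominated_convergence (fun _ => Real.pi) ?_ ?_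
    (integrable_const _) ?_
  · refine Eventually.of_forall fun ε => Measurable.aestronglyMeasurable ?_
    exact Complex.measurable_arg.comp (by fun_prop)
  · exact Eventually.of_forall fun ε => Eventually.of_forall fun t => Complex.abs_arg_le_pi _
  · filter_upwards [ae_mem_spectrum A φ] with t ht
    have htx : t ≠ x := fun h => hx (h ▸ ht)
    have hlim : Tendsto (fun ε : ℝ => (x : ℂ) + ε * Complex.I - t) (𝓝[>] 0)
        (𝓝[{w : ℂ | 0 ≤ w.im}] ((x : ℂ) - t)) := by
      refine tendsto_nhdsWithin_iff.2 ⟨?_, ?_⟩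
      · have : Continuous fun ε : ℝ => (x : ℂ) + ε * Complex.I - t := by fun_prop
        have h0 := this.tendsto 0
        simp only [Complex.ofReal_zero, zero_mul, add_zero] at h0
        exact h0.mono_left nhdsWithin_le_nhds
      · filter_upwards [self_mem_nhdsWithin] with ε hε
        simpa using (Set.mem_Ioi.1 hε).le
    -- On the negative axis `arg` is continuous only from the closed upper half-plane, and at 0 it
    -- is not; the latter is avoided because `x` is off the spectrum.
    have hc : ContinuousWithinAt Complex.arg {w : ℂ | 0 ≤ w.im} ((x : ℂ) - t) := by
      rcases lt_or_gt_of_ne htx with h | h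
      · refine (Complex.continuousAt_arg ?_).continuousWithinAt
        left
        simpa using h
      · exact Complex.continuousWithinAt_arg_of_re_neg_of_im_zero (by simpa using h) (by simp)
    exact hc.tendsto.comp hlim

theorem spectralMeasure_Iio_eq {A : K →L[ℂ] K} (φ : K) {x y : ℝ}
    (h : Set.uIcc x y ⊆ (spectrum ℝ A)ᶜ) :
    spectralMeasure A φ (Set.Iio x) = spectralMeasure A φ (Set.Iio y) := by
  refine measure_congr ?_
  filter_upwards [ae_mem_spectrum A φ] with t ht
  have ht' : t ∉ Set.uIcc x y := fun hc => h hc ht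
  rw [Set.mem_uIcc] at ht'
  refine propext ⟨fun hx => ?_, fun hy => ?_⟩
  · exact lt_of_not_ge fun hc => ht' (Or.inr ⟨hc, le_of_lt hx⟩)
  · exact lt_of_not_ge fun hc => ht' (Or.inl ⟨hc, le_of_lt hy⟩)

theorem spectralMeasure_real_Iio_add_Ioi {A : K →L[ℂ] K} (hA : IsSelfAdjoint A) {φ : K}
    (hφ : ‖φ‖ = 1) {x : ℝ} (hx : x ∉ spectrum ℝ A) :
    (spectralMeasure A φ).real (Set.Iio x) + (spectralMeasure A φ).real (Set.Ioi x) = 1 := by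
  have := isProbabilityMeasure_spectralMeasure hA hφ
  have h1 : (spectralMeasure A φ).real (Set.Iio x) = (spectralMeasure A φ).real (Set.Iic x) := by
    refine measureReal_congr ?_
    filter_upwards [ae_mem_spectrum A φ] with t ht
    exact propext ⟨fun h => le_of_lt h, fun h => lt_of_le_of_ne h fun hc => hx (hc ▸ ht)⟩
  rw [h1, ← Set.compl_Iic, probReal_compl_eq_one_sub measurableSet_Iic]
  ring

end LogPotential

theorem Complex.exp_div_norm_exp (w : ℂ) : exp w / ‖exp w‖ = exp (w.im * I) := by
  rw [norm_exp, ofReal_exp, ← exp_sub]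
  congr 1
  linear_combination -re_add_im w

/-! ### Integrality in the gaps -/

namespace JacobiParameters

open MultiGraph Cover EllTwo MeasureTheory Filter Topology

variable {V E : Type*} [Fintype V] [Fintype E] {G : MultiGraph V E} (J : JacobiParameters G)
  {v₀ : V} {lift : V → G.Cover v₀} (hlift : ∀ v, (lift v).proj = v)

theorem _root_.EllTwo.norm_delta {X : Type*} (x : X) : ‖delta x‖ = 1 := by
  classical
  rw [delta, lp.norm_single (by norm_num)]
  simp

/-- The logarithmic potential of the sum of the spectral measures. -/
noncomputable def logPotential (lift : V → G.Cover v₀) (z : ℂ) : ℂ :=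
  ∑ v, ∫ t : ℝ, Complex.log (z - t) ∂(spectralMeasure (J.H v₀) (delta (lift v)))

/-- The Green function expression that agrees with the exponential of the logarithmic potential up
to a constant factor. -/
noncomputable def greenQuotient (O : Finset E) (z : ℂ) : ℂ :=
  (∏ e ∈ O, (1 + J.a e * J.edgeGreen hlift e z)) / ∏ v, J.vertexGreen lift v z

theorem vertexGreen_ne_zero_of_im {z : ℂ} (hz : z.im ≠ 0) (v : V) :
    J.vertexGreen lift v z ≠ 0 := by
  rw [vertexGreen, green_eq_inner]
  exact (J.isSelfAdjoint_H v₀).inner_resolvent_self_ne_zero hz (delta_ne_zero _)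

theorem hasDerivAt_logPotential {z : ℂ} (hz : 0 < z.im) :
    HasDerivAt (J.logPotential lift) (∑ v, J.vertexGreen lift v z) z := by
  have h : ∀ v, J.vertexGreen lift v z
      = ∫ t : ℝ, (z - t)⁻¹ ∂(spectralMeasure (J.H v₀) (delta (lift v))) := fun v => by
    rw [vertexGreen, green_eq_inner,
      inner_resolvent_eq_integral (J.isSelfAdjoint_H v₀) _ hz.ne']
  simp only [h]
  exact HasDerivAt.fun_sum fun v _ => hasDerivAt_integral_log _ _ hz

theorem differentiableAt_greenQuotient (O : Finset E) {z : ℂ} (hz : z ∈ resolventSet ℂ (J.H v₀))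
    (h0 : ∀ v, J.vertexGreen lift v z ≠ 0) :
    DifferentiableAt ℂ (J.greenQuotient hlift O) z :=
  DifferentiableAt.fun_div
    (.fun_finsetProd fun e _ => ((J.differentiableAt_edgeGreen hlift hz e).const_mul _).const_add _)
    (.fun_finsetProd fun v _ => J.differentiableAt_vertexGreen hz v)
    (Finset.prod_ne_zero_iff.2 fun v _ => h0 v)

theorem greenQuotient_ne_zero (O : Finset E) {z : ℂ} (hz : z ∈ resolventSet ℂ (J.H v₀))
    (h0 : ∀ v, J.vertexGreen lift v z ≠ 0) : J.greenQuotient hlift O z ≠ 0 :=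
  div_ne_zero (Finset.prod_ne_zero_iff.2 fun e _ => J.edgeGreen_factor_ne_zero hlift hz h0 e)
    (Finset.prod_ne_zero_iff.2 fun v _ => h0 v)

theorem star_greenQuotient (O : Finset E) {z : ℂ} (hz : z ∈ resolventSet ℂ (J.H v₀)) :
    star (J.greenQuotient hlift O z) = J.greenQuotient hlift O (star z) := by
  simp only [greenQuotient, vertexGreen, edgeGreen, star_div₀, star_prod, star_add, star_mul',
    J.star_green hz, star_one]
  simp

/-- Both sides are nowhere zero on the connected upper half-plane and have the same logarithmic
derivative, the sum of the diagonal Green functions. -/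
theorem exists_exp_logPotential_eq {O : Finset E}
    (hO : ∀ f : E → ℂ, ∑ e, f e = ∑ e ∈ O, (f e + f (G.rev e))) :
    ∃ c : ℂ, c ≠ 0 ∧ ∀ z : ℂ, 0 < z.im →
      Complex.exp (J.logPotential lift z) = c * J.greenQuotient hlift O z := by
  have hr : ∀ z : ℂ, 0 < z.im → z ∈ resolventSet ℂ (J.H v₀) := fun z hz =>
    (J.isSelfAdjoint_H v₀).mem_resolventSet_of_im_ne_zero hz.ne'
  have h0 : ∀ z : ℂ, 0 < z.im → ∀ v, J.vertexGreen lift v z ≠ 0 := fun z hz v =>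
    J.vertexGreen_ne_zero_of_im hz.ne' v
  have hd : ∀ z : ℂ, 0 < z.im → HasDerivAt (fun w => Complex.exp (J.logPotential lift w))
      (Complex.exp (J.logPotential lift z) * ∑ v, J.vertexGreen lift v z) z := fun z hz =>
    (J.hasDerivAt_logPotential hz).cexp
  have key := logDeriv_eqOn_iff (f := fun w => Complex.exp (J.logPotential lift w))
    (g := J.greenQuotient hlift O) (s := {z : ℂ | 0 < z.im})
    (fun z hz => (hd z hz).differentiableAt.differentiableWithinAt)
    (fun z hz => (J.differentiableAt_greenQuotient hlift O (hr z hz)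
      (h0 z hz)).differentiableWithinAt)
    (isOpen_lt continuous_const Complex.continuous_im)
    (convex_halfSpace_im_gt 0).isPreconnected
    (fun z hz => J.greenQuotient_ne_zero hlift O (hr z hz) (h0 z hz))
    (fun z _ => Complex.exp_ne_zero _)
  obtain ⟨c, hc, h⟩ := key.1 fun z hz => by
    have h1 : logDeriv (J.greenQuotient hlift O) z = _ :=
      J.logDeriv_greenQuotient hlift (hr z hz) hO (h0 z hz)
    rw [h1, logDeriv_apply, (hd z hz).deriv, mul_div_cancel_left₀ _ (Complex.exp_ne_zero _)]
  exact ⟨c, hc, fun z hz => h hz⟩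

/-- The phase of the Green function expression counts the spectrum above a point in a gap. -/
theorem exp_two_pi_mul_eq {O : Finset E} {c : ℂ} (hc : c ≠ 0)
    (h : ∀ z : ℂ, 0 < z.im →
      Complex.exp (J.logPotential lift z) = c * J.greenQuotient hlift O z)
    {x : ℝ} (hx : x ∉ spectrum ℝ (J.H v₀)) (h0 : ∀ v, J.vertexGreen lift v x ≠ 0) :
    Complex.exp (2 * Real.pi * Complex.I *
      ((∑ v, (spectralMeasure (J.H v₀) (delta (lift v))).real (Set.Ioi x) : ℝ) : ℂ))
      = (c / ‖c‖) ^ 2 := by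
  have hxr : (x : ℂ) ∈ resolventSet ℂ (J.H v₀) := by
    by_contra hc
    exact hx (ofReal_mem_spectrum_iff.1 hc)
  set N : ℝ := ∑ v, (spectralMeasure (J.H v₀) (delta (lift v))).real (Set.Ioi x) with hN
  set q := J.greenQuotient hlift O x with hq
  have hq0 : q ≠ 0 := J.greenQuotient_ne_zero hlift O hxr h0
  -- The Green function is real in the gaps.
  have hqs : star q = q := by
    rw [hq, J.star_greenQuotient hlift O hxr]
    simp
  have him : ∀ z : ℂ, 0 < z.im → (J.logPotential lift z).im
      = ∑ v, ∫ t : ℝ, Complex.arg (z - t) ∂(spectralMeasure (J.H v₀) (delta (lift v))) := by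
    intro z hz
    rw [logPotential, Complex.im_sum]
    exact Finset.sum_congr rfl fun v _ => im_integral_log _ _ hz
  have hpos : ∀ ε : ℝ, 0 < ε → 0 < ((x : ℂ) + ε * Complex.I).im := fun ε hε => by simpa using hε
  have hl : Tendsto (fun ε : ℝ => Complex.exp ((J.logPotential lift (x + ε * Complex.I)).im
      * Complex.I)) (𝓝[>] 0) (𝓝 (Complex.exp ((Real.pi * N : ℝ) * Complex.I))) := by
    refine ((Complex.continuous_exp.comp (Complex.continuous_ofReal.mul continuous_const)).tendsto
      (Real.pi * N)).comp ?_
    have := tendsto_finsetSum Finset.univ fun v _ =>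
      tendsto_integral_arg (J.H v₀) (delta (lift v)) hx
    rw [← Finset.mul_sum] at this
    refine this.congr' ?_
    filter_upwards [self_mem_nhdsWithin] with ε hε
    exact (him _ (hpos ε hε)).symm
  have hpath : Tendsto (fun ε : ℝ => (x : ℂ) + ε * Complex.I) (𝓝[>] 0) (𝓝 x) := by
    have : Continuous fun ε : ℝ => (x : ℂ) + ε * Complex.I := by fun_prop
    have h0 := this.tendsto 0
    simp only [Complex.ofReal_zero, zero_mul, add_zero] at h0
    exact h0.mono_left nhdsWithin_le_nhds
  have hQ : Tendsto (fun ε : ℝ => c * J.greenQuotient hlift O (x + ε * Complex.I)) (𝓝[>] 0)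
      (𝓝 (c * q)) :=
    ((J.differentiableAt_greenQuotient hlift O hxr h0).continuousAt.tendsto.comp hpath).const_mul c
  -- The same limit computed from the Green function: the phase of exp L is the phase of c Q.
  have hr : Tendsto (fun ε : ℝ => Complex.exp ((J.logPotential lift (x + ε * Complex.I)).im
      * Complex.I)) (𝓝[>] 0) (𝓝 (c * q / ‖c * q‖)) := by
    refine (hQ.div ((Complex.continuous_ofReal.tendsto _).comp hQ.norm)
      (by simpa using ⟨hc, hq0⟩)).congr' ?_
    filter_upwards [self_mem_nhdsWithin] with ε hε
    rw [← Complex.exp_div_norm_exp, h _ (hpos ε hε)]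
    rfl
  have heq := tendsto_nhds_unique hl hr
  -- Squaring removes the unknown sign of the real number `q`, which is why the exponent is 2πi and
  -- not πi.
  have hqq : q ^ 2 = (‖q‖ : ℂ) ^ 2 := by
    rw [← Complex.mul_conj', ← Complex.star_def, hqs, sq]
  have hqn : (‖q‖ : ℂ) ≠ 0 := by simpa using hq0
  have hexp : Complex.exp (2 * Real.pi * Complex.I * (N : ℂ))
      = Complex.exp ((Real.pi * N : ℝ) * Complex.I) ^ 2 := by
    rw [← Complex.exp_nat_mul]
    congr 1
    push_cast
    ring
  rw [hexp, heq, norm_mul, Complex.ofReal_mul, div_pow, div_pow, mul_pow, mul_pow, hqq,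
    mul_div_mul_right _ _ (pow_ne_zero 2 hqn)]

/-- The diagonal entries of the resolvent are strictly monotone in the gaps, so that their zeros are
isolated. -/
theorem exists_vertexGreen_ne_zero {x : ℝ} (hx : x ∉ spectrum ℝ (J.H v₀)) :
    ∃ y : ℝ, Set.uIcc x y ⊆ (spectrum ℝ (J.H v₀))ᶜ ∧ ∀ v, J.vertexGreen lift v y ≠ 0 := by
  have hxr : (x : ℂ) ∈ resolventSet ℂ (J.H v₀) := by
    by_contra hc
    exact hx (ofReal_mem_spectrum_iff.1 hc)
  have h1 : ∀ v, ∀ᶠ y : ℝ in 𝓝[≠] x, J.vertexGreen lift v y ≠ 0 := by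
    intro v
    refine ((J.hasDerivAt_green hxr (lift v) (lift v)).comp_ofReal).eventually_ne ?_
    rw [sq, mul_apply_eq_comp, neg_ne_zero]
    have h := (J.isSelfAdjoint_H v₀).inner_resolvent hxr (delta (lift v))
      (resolvent (J.H v₀) (x : ℂ) (delta (lift v)))
    rw [show star (x : ℂ) = x by simp] at h
    -- At a real point the derivative is -‖R δ‖², where R is the resolvent.
    rw [← h, inner_self_ne_zero]
    intro h0
    have := smul_resolvent_sub hxr (delta (lift v))
    rw [h0] at this
    exact delta_ne_zero (lift v) (by simpa using this.symm)
  obtain ⟨r, hr, hball⟩ := Metric.isOpen_iff.1 (spectrum.isClosed (𝕜 := ℝ) (J.H v₀)).isOpen_compl x hx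
  have h2 : ∀ᶠ y : ℝ in 𝓝[≠] x, y ∈ Metric.ball x r :=
    nhdsWithin_le_nhds (Metric.ball_mem_nhds x hr)
  obtain ⟨y, hy, hyr⟩ := ((eventually_all.2 h1).and h2).exists
  exact ⟨y, ((convex_ball x r).ordConnected.uIcc_subset (Metric.mem_ball_self hr) hyr).trans hball,
    hy⟩

include hlift in
/-- Gap labelling: the unnormalized integrated density of states is an integer in the gaps. -/
theorem exists_nat_sum_spectralMeasure_Iio_eq {x : ℝ} (hx : x ∉ spectrum ℝ (J.H v₀)) :
    ∃ m : ℕ, ∑ v, spectralMeasure (J.H v₀) (delta (lift v)) (Set.Iio x) = m := by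
  obtain ⟨O, hO⟩ := G.exists_orientation
  obtain ⟨c, hc, h⟩ := J.exists_exp_logPotential_eq hlift hO
  obtain ⟨M, hM⟩ := (spectrum.isCompact (𝕜 := ℝ) (J.H v₀)).bddAbove
  have hadd := fun {y : ℝ} (hy : y ∉ spectrum ℝ (J.H v₀)) v =>
    spectralMeasure_real_Iio_add_Ioi (J.isSelfAdjoint_H v₀) (norm_delta (lift v)) hy
  -- A reference point above the whole spectrum, where the count is 0; it fixes (c/|c|)² = 1.
  obtain ⟨y₁, hy₁, h₁⟩ := J.exists_vertexGreen_ne_zero (lift := lift)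
    (x := M + 1) fun hc => by linarith [hM hc]
  obtain ⟨y, hy, h₂⟩ := J.exists_vertexGreen_ne_zero (lift := lift) hx
  have hys := hy Set.right_mem_uIcc
  have hys₁ := hy₁ Set.right_mem_uIcc
  have e₁ := J.exp_two_pi_mul_eq hlift hc h hys₁ h₁
  have e := J.exp_two_pi_mul_eq hlift hc h hys h₂
  have hN₁ : ∑ v, (spectralMeasure (J.H v₀) (delta (lift v))).real (Set.Ioi y₁) = 0 := by
    refine Finset.sum_eq_zero fun v _ => ?_
    have h1 := hadd hys₁ v
    have h2 : (spectralMeasure (J.H v₀) (delta (lift v))).real (Set.Iio y₁) = 1 := by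
      have := isProbabilityMeasure_spectralMeasure (J.isSelfAdjoint_H v₀) (norm_delta (lift v))
      rw [measureReal_def, ← spectralMeasure_Iio_eq _ hy₁]
      have : spectralMeasure (J.H v₀) (delta (lift v)) (Set.Iio (M + 1)) = 1 := by
        rw [prob_compl_eq_zero_iff measurableSet_Iio |>.symm]
        refine measure_mono_null (t := (spectrum ℝ (J.H v₀))ᶜ) (fun t ht hs => ?_)
          (spectralMeasure_compl_spectrum _ _)
        have := hM hs
        simp only [Set.compl_Iio, Set.mem_Ici] at ht
        linarith
      rw [this, ENNReal.toReal_one]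
    linarith
  rw [hN₁, Complex.ofReal_zero, mul_zero, Complex.exp_zero] at e₁
  rw [← e₁, Complex.exp_eq_one_iff] at e
  obtain ⟨n, hn⟩ := e
  have hn' : ∑ v, (spectralMeasure (J.H v₀) (delta (lift v))).real (Set.Ioi y) = n := by
    have : (2 * Real.pi * Complex.I : ℂ) ≠ 0 := Complex.two_pi_I_ne_zero
    rw [mul_comm] at hn
    exact_mod_cast mul_right_cancel₀ this hn
  have hsum : ∑ v, (spectralMeasure (J.H v₀) (delta (lift v))).real (Set.Iio y)
      = ((Fintype.card V - n : ℤ) : ℝ) := by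
    have : ∑ v, ((spectralMeasure (J.H v₀) (delta (lift v))).real (Set.Iio y)
        + (spectralMeasure (J.H v₀) (delta (lift v))).real (Set.Ioi y)) = Fintype.card V := by
      rw [Finset.sum_congr rfl fun v _ => hadd hys v]
      simp
    rw [Finset.sum_add_distrib, hn'] at this
    push_cast
    linarith
  have hnn : (0 : ℤ) ≤ Fintype.card V - n := by
    have : (0 : ℝ) ≤ ((Fintype.card V - n : ℤ) : ℝ) := by
      rw [← hsum]
      positivity
    exact_mod_cast this
  refine ⟨(Fintype.card V - n : ℤ).toNat, ?_⟩
  rw [Finset.sum_congr rfl fun v _ => spectralMeasure_Iio_eq (delta (lift v)) hy]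
  have hfin : ∑ v, spectralMeasure (J.H v₀) (delta (lift v)) (Set.Iio y) ≠ ⊤ :=
    ENNReal.sum_ne_top.2 fun v _ => measure_ne_top _ _
  rw [← ENNReal.toReal_eq_toReal_iff' hfin (ENNReal.natCast_ne_top _), ENNReal.toReal_sum
    fun v _ => measure_ne_top _ _, ENNReal.toReal_natCast]
  refine Eq.trans hsum ?_
  rw [← Int.cast_natCast (R := ℝ), Int.toNat_of_nonneg hnn]

end JacobiParameters

/-! ### The support of the density of states and the number of components -/

section SpectralMeasure

open MeasureTheory

variable {K : Type*} [NormedAddCommGroup K] [InnerProductSpace ℂ K] [CompleteSpace K]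

/-- A substitute for the spectral projection of a neighbourhood `U` of a point of the spectrum. -/
theorem exists_localized_cfc_ne_zero {A : K →L[ℂ] K} (hA : IsSelfAdjoint A) {t : ℝ}
    (ht : t ∈ spectrum ℝ A) {U : Set ℝ} (hU : IsOpen U) (htU : t ∈ U) :
    ∃ B : K →L[ℂ] K, IsSelfAdjoint B ∧ B ≠ 0 ∧ (∀ C, Commute A C → Commute B C) ∧
      ∀ φ, spectralMeasure A φ U = 0 → B φ = 0 := by
  obtain ⟨h, h1, h0, -, -⟩ := exists_continuous_one_zero_of_isCompact (isCompact_singleton (x := t))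
    hU.isClosed_compl (Set.disjoint_left.2 fun s hs hs' => hs' (by rwa [Set.mem_singleton_iff.1 hs]))
  have hBs : IsSelfAdjoint (cfc (h : ℝ → ℝ) A) := cfc_predicate _ _
  refine ⟨cfc (h : ℝ → ℝ) A, hBs, fun hB0 => ?_, fun C hC => hC.cfc_real h, fun φ hφ => ?_⟩
  -- By spectral mapping, h(t) = 1 lies in the spectrum of h(A).
  · have hmem : (1 : ℝ) ∈ spectrum ℝ (cfc (h : ℝ → ℝ) A) := by
      rw [cfc_map_spectrum (h : ℝ → ℝ) A hA h.continuous.continuousOn]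
      exact ⟨t, ht, h1 rfl⟩
    rw [hB0, spectrum.mem_iff] at hmem
    exact hmem (by simp)
  -- ‖h(A) φ‖² = ∫ h² dμ, and `h` vanishes off `U`.
  · have hi := integral_spectralMeasure_of_continuous A φ
      (f := fun s => h s * h s) (h.continuous.mul h.continuous)
    rw [integral_eq_zero_of_ae, cfc_mul _ _ _ h.continuous.continuousOn h.continuous.continuousOn,
      mul_apply_eq_comp] at hi
    · have hs := hBs.isSymmetric φ (cfc (h : ℝ → ℝ) A φ)
      simp only [ContinuousLinearMap.coe_coe] at hs
      rw [← hs, inner_self_eq_norm_sq_to_K] at hi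
      have : ‖cfc (h : ℝ → ℝ) A φ‖ ^ 2 = 0 := by
        rw [hi, ← RCLike.ofReal_pow]
        rfl
      simpa using this
    · have hn : ∀ᵐ s ∂(spectralMeasure A φ), s ∉ U := measure_eq_zero_iff_ae_notMem.1 hφ
      filter_upwards [hn] with s hs
      have : h s = 0 := h0 hs
      simp [this]

end SpectralMeasure

namespace JacobiParameters

open MultiGraph Cover EllTwo MeasureTheory Filter Topology

variable {V E : Type*} [Fintype V] [Fintype E] {G : MultiGraph V E} (J : JacobiParameters G)
  {v₀ : V} {lift : V → G.Cover v₀} (hlift : ∀ v, (lift v).proj = v)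

include hlift

/-- The density of states charges every neighbourhood of every point of the spectrum. -/
theorem exists_spectralMeasure_ne_zero {t : ℝ} (ht : t ∈ spectrum ℝ (J.H v₀)) {U : Set ℝ}
    (hU : IsOpen U) (htU : t ∈ U) : ∃ v, spectralMeasure (J.H v₀) (delta (lift v)) U ≠ 0 := by
  by_contra! hzero
  obtain ⟨B, hBs, hB, hcomm, hBφ⟩ :=
    exists_localized_cfc_ne_zero (J.isSelfAdjoint_H v₀) ht hU htU
  -- `B` kills δ at the chosen lifts. It commutes with everything that commutes with H, in
  -- particular with deck transformations, so it kills every δ and is 0.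
  have hdelta : ∀ x, B (delta x) = 0 := by
    intro x
    obtain ⟨φ, hφ, hx⟩ := exists_deckTransformation x (lift x.proj) (hlift _).symm
    have hc := congrArg (fun A => A (delta (lift x.proj))) (hcomm _ (J.commute_shift v₀ hφ)).eq
    simp only [mul_apply_eq_comp, shift_equiv_delta] at hc
    rw [hBφ _ (hzero _), map_zero, ← hx, φ.symm_apply_apply] at hc
    exact hc
  refine hB (ContinuousLinearMap.ext fun ψ => lp.ext (funext fun x => ?_))
  have hs := hBs.isSymmetric (delta x) ψ
  simp only [ContinuousLinearMap.coe_coe] at hs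
  rw [← inner_delta_left, ← hs, hdelta, inner_zero_left]
  rfl

theorem sum_spectralMeasure_Iio_lt {t x y : ℝ} (ht : t ∈ spectrum ℝ (J.H v₀)) (hx : x < t)
    (hy : t < y) :
    ∑ v, spectralMeasure (J.H v₀) (delta (lift v)) (Set.Iio x)
      < ∑ v, spectralMeasure (J.H v₀) (delta (lift v)) (Set.Iio y) := by
  obtain ⟨w, hw⟩ := J.exists_spectralMeasure_ne_zero hlift ht isOpen_Ioo ⟨hx, hy⟩
  set μ := fun v => spectralMeasure (J.H v₀) (delta (lift v)) with hμ
  calc ∑ v, μ v (Set.Iio x) < ∑ v, μ v (Set.Iio x) + ∑ v, μ v (Set.Ioo x y) :=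
        ENNReal.lt_add_right (ENNReal.sum_ne_top.2 fun v _ => measure_ne_top _ _)
          fun h => hw (Finset.sum_eq_zero_iff.1 h w (Finset.mem_univ _))
    _ = ∑ v, μ v (Set.Iio x ∪ Set.Ioo x y) := by
        rw [← Finset.sum_add_distrib]
        refine Finset.sum_congr rfl fun v _ => (measure_union ?_ measurableSet_Ioo).symm
        exact Set.disjoint_left.2 fun s hs hs' => lt_asymm hs hs'.1
    _ ≤ ∑ v, μ v (Set.Iio y) := by
        refine Finset.sum_le_sum fun v _ => measure_mono (Set.union_subset ?_ fun s hs => hs.2)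
        exact Set.Iio_subset_Iio (hx.trans hy).le

theorem card_connectedComponents_spectrum_le :
    ENat.card (ConnectedComponents (spectrum ℂ (J.H v₀))) ≤ (Fintype.card V : ℕ∞) := by
  classical
  set n : ℝ → ℝ≥0∞ := fun y => ∑ v, spectralMeasure (J.H v₀) (delta (lift v)) (Set.Iio y) with hn
  set S := spectrum ℝ (J.H v₀) with hS
  -- The smallest value of the integer count `n` at a point off the spectrum to the right of `t`; it
  -- labels the component of `t`.
  let f : ℝ → ℕ := fun t => sInf {m : ℕ | ∃ y, y ∉ S ∧ t < y ∧ n y = m}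
  have hcompact : IsCompact S := spectrum.isCompact (𝕜 := ℝ) (J.H v₀)
  obtain ⟨M, hM⟩ := hcompact.bddAbove
  have hf : ∀ t ∈ S, ∃ y, y ∉ S ∧ t < y ∧ n y = f t := by
    intro t ht
    refine Nat.sInf_mem (s := {m : ℕ | ∃ y, y ∉ S ∧ t < y ∧ n y = m}) ?_
    have hMS : M + 1 ∉ S := fun hc => by linarith [hM hc]
    obtain ⟨m, hm⟩ := J.exists_nat_sum_spectralMeasure_Iio_eq hlift hMS
    exact ⟨m, M + 1, hMS, by linarith [hM ht], hm⟩
  have hf1 : ∀ t ∈ S, f t ∈ Finset.Icc 1 (Fintype.card V) := by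
    intro t ht
    obtain ⟨y, hy, hty, hny⟩ := hf t ht
    rw [Finset.mem_Icc, Nat.one_le_iff_ne_zero]
    constructor
    · intro h0
      have := J.sum_spectralMeasure_Iio_lt hlift ht (x := t - 1) (by linarith) hty
      change _ < n y at this
      rw [hny, h0] at this
      simp at this
    · have : n y ≤ Fintype.card V := by
        calc n y ≤ ∑ v : V, 1 := by
              refine Finset.sum_le_sum fun v _ => ?_
              have := isProbabilityMeasure_spectralMeasure (J.isSelfAdjoint_H v₀)
                (norm_delta (lift v))
              exact prob_le_one
          _ = Fintype.card V := by simp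
      rw [hny] at this
      exact_mod_cast this
  have hlt : ∀ t ∈ S, ∀ s ∈ S, ∀ y, y ∉ S → t < y → y < s → f t < f s := by
    intro t ht s hs y hy hty hys
    obtain ⟨m, hm⟩ := J.exists_nat_sum_spectralMeasure_Iio_eq hlift hy
    obtain ⟨x, hx, hsx, hnx⟩ := hf s hs
    have h1 : f t ≤ m := Nat.sInf_le ⟨y, hy, hty, hm⟩
    have h2 := J.sum_spectralMeasure_Iio_lt hlift hs hys hsx
    change _ < n x at h2
    rw [hm, hnx] at h2
    exact h1.trans_lt (by exact_mod_cast h2)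
  have hreal : ∀ z : spectrum ℂ (J.H v₀), ((z.1.re : ℝ) : ℂ) = z.1 := fun z =>
    Complex.ext rfl (by simpa using ((J.isSelfAdjoint_H v₀).im_eq_zero_of_mem_spectrum z.2).symm)
  have hmem : ∀ z : spectrum ℂ (J.H v₀), z.1.re ∈ S := fun z =>
    ofReal_mem_spectrum_iff.1 (by rw [hreal]; exact z.2)
  have hcomp : ∀ z w : spectrum ℂ (J.H v₀), z.1.re ≤ w.1.re → f z.1.re = f w.1.re →
      (z : ConnectedComponents (spectrum ℂ (J.H v₀))) = w := by
    intro z w hzw hfe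
    -- A gap point between the two would make `f` jump, so equal labels force the whole segment into
    -- the spectrum.
    have hsub : ∀ y ∈ Set.Icc z.1.re w.1.re, (y : ℂ) ∈ spectrum ℂ (J.H v₀) := by
      intro y hy
      rw [ofReal_mem_spectrum_iff]
      by_contra hyS
      have h1 : z.1.re < y := lt_of_le_of_ne hy.1 fun h => hyS (h ▸ hmem z)
      have h2 : y < w.1.re := lt_of_le_of_ne hy.2 fun h => hyS (h ▸ hmem w)
      exact (hlt _ (hmem z) _ (hmem w) y hyS h1 h2).ne hfe
    let g : Set.Icc z.1.re w.1.re → spectrum ℂ (J.H v₀) := fun y => ⟨(y.1 : ℂ), hsub y.1 y.2⟩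
    have hg : Continuous g := by fun_prop
    have : PreconnectedSpace (Set.Icc z.1.re w.1.re) :=
      Subtype.preconnectedSpace isPreconnected_Icc
    rw [ConnectedComponents.coe_eq_coe']
    refine (isPreconnected_range hg).subset_connectedComponent
      ⟨⟨w.1.re, hzw, le_rfl⟩, Subtype.ext (hreal w)⟩ ⟨⟨z.1.re, le_rfl, hzw⟩, Subtype.ext (hreal z)⟩
  choose r hr using ConnectedComponents.surjective_coe (α := spectrum ℂ (J.H v₀))
  let F : ConnectedComponents (spectrum ℂ (J.H v₀)) → Finset.Icc 1 (Fintype.card V) :=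
    fun c => ⟨f (r c).1.re, hf1 _ (hmem _)⟩
  have hF : Function.Injective F := by
    intro c d hcd
    have hfe : f (r c).1.re = f (r d).1.re := congrArg Subtype.val hcd
    rw [← hr c, ← hr d]
    rcases le_total (r c).1.re (r d).1.re with h | h
    · exact hcomp _ _ h hfe
    · exact (hcomp _ _ h hfe.symm).symm
  refine (ENat.card_le_card_of_injective hF).trans ?_
  rw [ENat.card_eq_coe_fintype_card, Fintype.card_coe, Nat.card_Icc, Nat.add_sub_cancel]

omit hlift

theorem ids_eq (t : ℝ) : J.ids v₀ lift t
    = (∑ v, spectralMeasure (J.H v₀) (delta (lift v)) (Set.Iio t)) / (Fintype.card V : ℝ≥0∞) := by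
  rw [ids, densityOfStates, Measure.smul_apply, Measure.finsetSum_apply, smul_eq_mul,
    ENNReal.div_eq_inv_mul]

end JacobiParameters

/-- Gap labelling for periodic Jacobi matrices on trees. The universal cover is built from an
arbitrary base vertex `v₀`, and `lift` is an arbitrary choice of one vertex of the universal cover
over each vertex of the finite graph. -/
theorem theorem1p1 {V E : Type*} [Fintype V] [Fintype E] (G : MultiGraph V E)
    (hconn : G.Connected) (hleaf : G.Leafless) (J : JacobiParameters G) (v₀ : V)
    (lift : V → G.Cover v₀) (hlift : ∀ v, (lift v).proj = v) :
    (∀ I : Set ℝ, IsSpectralGap (J.H v₀) I →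
      ∃ m : ℕ, ∀ t ∈ I, J.ids v₀ lift t = (m : ℝ≥0∞) / (Fintype.card V : ℝ≥0∞)) ∧
    ENat.card (ConnectedComponents (spectrum ℂ (J.H v₀))) ≤ (Fintype.card V : ℕ∞) := by
  refine ⟨?_, J.card_connectedComponents_spectrum_le hlift⟩
  rintro I ⟨t₀, ht₀, rfl⟩
  obtain ⟨m, hm⟩ := J.exists_nat_sum_spectralMeasure_Iio_eq hlift
    (fun h => ht₀ (ofReal_mem_spectrum_iff.2 h))
  refine ⟨m, fun t ht => ?_⟩
  -- A component of a subset of the line is an interval, so no spectrum lies between two of its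
  -- points and the count is the same at both.
  have hsub : Set.uIcc t t₀ ⊆ (spectrum ℝ (J.H v₀))ᶜ := by
    intro s hs h
    have hI := (isPreconnected_connectedComponentIn.ordConnected.uIcc_subset ht
      (mem_connectedComponentIn ht₀)) hs
    exact (connectedComponentIn_subset _ _ hI) (ofReal_mem_spectrum_iff.2 h)
  rw [J.ids_eq, ← hm, Finset.sum_congr rfl fun v _ =>
    spectralMeasure_Iio_eq (EllTwo.delta (lift v)) hsub]
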